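/- Let $H\subseteq GL(N,\mathbb C)$ be a compact matrix Lie group whose Lie algebra $\mathfrak h=\{X : e^{tX}\in H\ \forall t\in\mathbb R\}$ is simple, equipped with the Killing scalar product $\langle X,Y\rangle=-\operatorname{tr}(\operatorname{ad}X\,\operatorname{ad}Y)$. For a compact matrix group $K$ let $\mathrm{Pol}(K)$ be the Hopf $*$-algebra of polynomial functions on $K$ (the $*$-algebra of functions generated by the matrix entries), with coproduct $\phi$ and counit $\epsilon$. Let $\mathcal B$ be a complex unital $*$-algebra and let $F^\star\colon\mathcal B\to\mathcal B\otimes\mathrm{Pol}(H)$ be a free action of $H$: a unital $*$-homomorphism with $(F^\star\otimes\mathrm{id})F^\star=(\mathrm{id}\otimes\phi)F^\star$ and $(\mathrm{id}\otimes\epsilon)F^\star=\mathrm{id}$, such that for each $a\in\mathrm{Pol}(H)$ there are finitely many $b_k,q_k\in\mathcal B$ with $\sum_k b_kF^\star(q_k)=1\otimes a$. Let $G\subseteq H$ be a compact subgroup with Lie algebra $\mathfrak g\subseteq\mathfrak h$, let $j\colon\mathrm{Pol}(H)\to\mathrm{Pol}(G)$ be the restriction map, $F=(\mathrm{id}\otimes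 j)F^\star$, $\mathcal V=\{f\in\mathcal B: F(f)=f\otimes1\}$, and let $i\colon\mathcal V\to\mathcal B$ be the inclusion. Let $(\xi_1,\dots,\xi_n)$ be an orthonormal basis of $\mathfrak g^\perp\subseteq\mathfrak h$, let $u_{ji}(g)=\langle\xi_j,\operatorname{Ad}_g\xi_i\rangle$ be the matrix elements of the adjoint representation $u$ of $G$ on $\mathfrak g^\perp$, and assume that the kernel of $u$ is discrete. For $\xi\in\mathfrak h$ and $a\in\mathrm{Pol}(H)$ write $\xi(a)=\frac{d}{dt}a(e^{t\xi})|_{t=0}$, and put $X_k=(\mathrm{id}\otimes\xi_k)F^\star\colon\mathcal B\to\mathcal B$ and $\partial_k=X_k|_{\mathcal V}\colon\mathcal V\to\mathcal B$. Then $\tau=(\partial_1,\dots,\partial_n)$ is a frame structure on $P=(\mathcal B,i,F)$ relative to $u$. That is: (a) $P$ is a quantum principal $G$-bundle: $F$ is a free action of $G$, $i$ is injective, and $i(\mathcal V)$ is the set of $F$-fixed elements of $\mathcal B$; (b) $u$ is a real unitary representation of $G$ with polynomial matrix elements and discrete kernel; (c) each $\partial_k$ is a hermitian derivation, i.e. linear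 with $\partial_k(fg)=\partial_k(f)g+f\partial_k(g)$ and $\partial_k(f^*)=\partial_k(f)^*$; (d) $F\partial_k(f)=\sum_j\partial_j(f)\otimes u_{jk}$ for all $k$ and all $f\in\mathcal V$; (e) there are $d\in\mathbb N$, $b_{k\alpha}\in\mathcal B$ and $v_{k\alpha}\in\mathcal V$ ($1\le k\le n$, $1\le\alpha\le d$) with $\sum_{\alpha}b_{k\alpha}\partial_j(v_{k\alpha})=\delta_{kj}1$ for all $k,j$. If moreover $[\mathfrak g^\perp,\mathfrak g^\perp]\subseteq\mathfrak g$, then $\tau$ is integrable, with extension $\widehat\tau=(X_1,\dots,X_n)$. That is, the $X_j$ are hermitian derivations of $\mathcal B$ with $FX_j=\sum_k(X_k\otimes u_{kj})F$, $X_j|_{\mathcal V}=\partial_j$ and $X_j\partial_k-X_k\partial_j=0$ for all $j,k$. Here $X_k\otimes u_{kj}$ denotes the map $b\otimes c\mapsto X_k(b)\otimes u_{kj}c$. -/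

import Mathlib

open scoped TensorProduct Matrix
open Matrix Filter Topology

attribute [local instance 100] LieRing.ofAssociativeRing

namespace FramedBundle

noncomputable section

/-! ### Compact matrix groups and their Lie algebras -/

section Exponential

lemma norm_pow_sub_pow_le {A : Type*} [NormedRing A] [NormOneClass A] (a b : A) {M : ℝ} (hM : 1 ≤ M) (ha : ‖a‖ ≤ M)
    (hb : ‖b‖ ≤ M) (n : ℕ) : ‖a ^ n - b ^ n‖ ≤ n * M ^ n * ‖a - b‖ := by
  have hM0 : 0 ≤ M := by linarith
  induction n with
  | zero => simp
  | succ n ih =>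
    have e : a ^ (n + 1) - b ^ (n + 1) = a ^ n * (a - b) + (a ^ n - b ^ n) * b := by
      rw [pow_succ, pow_succ]; noncomm_ring
    have h1 : ‖a ^ n‖ ≤ M ^ n := (norm_pow_le a n).trans (pow_le_pow_left₀ (norm_nonneg _) ha n)
    have h2 : M ^ n ≤ M ^ (n + 1) := pow_le_pow_right₀ hM (Nat.le_succ n)
    calc ‖a ^ (n + 1) - b ^ (n + 1)‖
        ≤ ‖a ^ n‖ * ‖a - b‖ + ‖a ^ n - b ^ n‖ * ‖b‖ := by
          rw [e]; exact (norm_add_le _ _).trans (add_le_add (norm_mul_le _ _) (norm_mul_le _ _))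
      _ ≤ M ^ n * ‖a - b‖ + (n * M ^ n * ‖a - b‖) * M := by gcongr
      _ ≤ M ^ (n + 1) * ‖a - b‖ + (n * M ^ n * ‖a - b‖) * M := by gcongr
      _ = (n + 1 : ℕ) * M ^ (n + 1) * ‖a - b‖ := by push_cast; ring

/-- If `γ` is a curve through `1` with velocity `X`, then `γ(1/n)^n` tends to `exp X`. -/
lemma tendsto_pow_exp {A : Type*} [NormedRing A] [NormedAlgebra ℝ A] [CompleteSpace A]
    [NormOneClass A] {γ : ℝ → A} {X : A} (h0 : γ 0 = 1)
    (hγ : HasDerivAt γ X 0) :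
    Tendsto (fun n : ℕ => γ ((n : ℝ)⁻¹) ^ n) atTop (𝓝 (NormedSpace.exp X)) := by
  let _ : NormedAlgebra ℚ A := NormedAlgebra.restrictScalars ℚ ℝ A
  set E : ℝ → A := fun t => NormedSpace.exp (t • X) with hE
  have hE0 : E 0 = 1 := by simp [hE]
  have hEd : HasDerivAt E X 0 := by
    have := hasDerivAt_exp_smul_const (𝕂 := ℝ) X (0 : ℝ)
    simpa [hE] using this
  have hinv : Tendsto (fun n : ℕ => ((n : ℝ)⁻¹)) atTop (𝓝 0) :=
    tendsto_inv_atTop_zero.comp tendsto_natCast_atTop_atTop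
  have hlit : (fun n : ℕ => γ ((n : ℝ)⁻¹) - E ((n : ℝ)⁻¹)) =o[atTop] fun n : ℕ => ((n : ℝ)⁻¹) := by
    have h : HasDerivAt (fun t => γ t - E t) (0 : A) 0 := by
      have := hγ.sub hEd
      rw [sub_self] at this
      exact this
    have := h.isLittleO
    simp only [h0, hE0, sub_self, sub_zero, smul_zero] at this
    exact this.comp_tendsto hinv
  have bound : ∀ δ : ℝ → A, δ 0 = 1 → HasDerivAt δ X 0 →
      ∀ᶠ n : ℕ in atTop, ‖δ ((n : ℝ)⁻¹)‖ ≤ 1 + (‖X‖ + 1) * (n : ℝ)⁻¹ := by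
    intro δ hδ0 hδ
    have := hδ.isLittleO
    simp only [hδ0, sub_zero] at this
    have h2 := (this.comp_tendsto hinv).bound one_pos
    filter_upwards [h2] with n hn
    simp only [Function.comp, one_mul] at hn
    have hn0 : (0 : ℝ) ≤ (n : ℝ)⁻¹ := by positivity
    rw [Real.norm_of_nonneg hn0] at hn
    have : δ ((n : ℝ)⁻¹) = 1 + (n : ℝ)⁻¹ • X + (δ ((n : ℝ)⁻¹) - 1 - (n : ℝ)⁻¹ • X) := by abel
    rw [this]
    refine (norm_add₃_le).trans ?_
    rw [norm_one, norm_smul, Real.norm_of_nonneg hn0]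
    linarith
  set C := ‖X‖ + 1 with hC
  have hC0 : 0 ≤ C := by positivity
  have hEn : ∀ᶠ n : ℕ in atTop, E ((n : ℝ)⁻¹) ^ n = NormedSpace.exp X := by
    filter_upwards [eventually_gt_atTop 0] with n hn
    have hn' : (n : ℝ) ≠ 0 := by positivity
    simp only [hE]
    rw [← NormedSpace.exp_nsmul, ← Nat.cast_smul_eq_nsmul ℝ, smul_smul, mul_inv_cancel₀ hn',
      one_smul]
  rw [tendsto_iff_norm_sub_tendsto_zero]
  have hz : Tendsto (fun n : ℕ => Real.exp C * (‖γ ((n : ℝ)⁻¹) - E ((n : ℝ)⁻¹)‖ / ((n : ℝ)⁻¹)))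
      atTop (𝓝 0) := by
    have := hlit.norm_left.tendsto_div_nhds_zero
    simpa using this.const_mul (Real.exp C)
  refine squeeze_zero' (Eventually.of_forall fun _ => norm_nonneg _) ?_ hz
  filter_upwards [bound γ h0 hγ, bound E hE0 hEd, hEn, eventually_gt_atTop 0] with n h1 h2 h3 hn
  have hn' : (0 : ℝ) < n := by positivity
  rw [← h3]
  have hM : (1 : ℝ) ≤ 1 + C * (n : ℝ)⁻¹ := by
    have : 0 ≤ C * (n : ℝ)⁻¹ := by positivity
    linarith
  refine (norm_pow_sub_pow_le _ _ hM h1 h2 n).trans ?_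
  have hpow : (1 + C * (n : ℝ)⁻¹) ^ n ≤ Real.exp C := by
    calc (1 + C * (n : ℝ)⁻¹) ^ n ≤ (Real.exp (C * (n : ℝ)⁻¹)) ^ n := by
          refine pow_le_pow_left₀ (by linarith) ?_ n
          rw [add_comm]; exact Real.add_one_le_exp _
      _ = Real.exp C := by
          rw [← Real.exp_nat_mul]; congr 1; field_simp
  calc (n : ℝ) * (1 + C * (n : ℝ)⁻¹) ^ n * ‖γ ((n : ℝ)⁻¹) - E ((n : ℝ)⁻¹)‖
      ≤ n * Real.exp C * ‖γ ((n : ℝ)⁻¹) - E ((n : ℝ)⁻¹)‖ := by gcongr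
    _ = _ := by field_simp

end Exponential

variable {N : ℕ}

/-- The matrix exponential, as an invertible matrix. -/
def expGL (X : Matrix (Fin N) (Fin N) ℂ) : GL (Fin N) ℂ where
  val := NormedSpace.exp X
  inv := NormedSpace.exp (-X)
  val_inv := by
    rw [← Matrix.exp_add_of_commute _ _ (Commute.neg_right (Commute.refl X))]; simp
  inv_val := by
    rw [← Matrix.exp_add_of_commute _ _ (Commute.neg_left (Commute.refl X))]; simp

/-- The set of all matrices `X` such that `exp(tX)` lies in the group for every real `t`. -/
def lieSet (H : Subgroup (GL (Fin N) ℂ)) : Set (Matrix (Fin N) (Fin N) ℂ) :=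
  {X | ∀ t : ℝ, expGL (t • X) ∈ H}


lemma coe_expGL (X : Matrix (Fin N) (Fin N) ℂ) :
    (expGL X : Matrix (Fin N) (Fin N) ℂ) = NormedSpace.exp X := rfl

lemma expGL_zero : expGL (0 : Matrix (Fin N) (Fin N) ℂ) = 1 := by
  ext1; simp [coe_expGL]

lemma expGL_conj (g : GL (Fin N) ℂ) (X : Matrix (Fin N) (Fin N) ℂ) :
    expGL ((g : Matrix (Fin N) (Fin N) ℂ) * X *
      ((g⁻¹ : GL (Fin N) ℂ) : Matrix (Fin N) (Fin N) ℂ)) = g * expGL X * g⁻¹ := by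
  ext1
  simp only [coe_expGL, Units.val_mul]
  exact Matrix.exp_units_conj g X

/-- The exponential curve of a matrix is differentiable, entry by entry. -/
lemma hasDerivAt_expGL (X : Matrix (Fin N) (Fin N) ℂ) (t : ℝ) :
    HasDerivAt (fun s : ℝ => (expGL (s • X) : Matrix (Fin N) (Fin N) ℂ))
      ((expGL (t • X) : Matrix (Fin N) (Fin N) ℂ) * X) t := by
  let _ : NormedRing (Matrix (Fin N) (Fin N) ℂ) := Matrix.linftyOpNormedRing
  let _ : NormedAlgebra ℝ (Matrix (Fin N) (Fin N) ℂ) := Matrix.linftyOpNormedAlgebra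
  exact hasDerivAt_exp_smul_const (𝕂 := ℝ) X t

/-- Velocities at `1` of curves in a compact matrix group belong to the Lie algebra. -/
lemma mem_lieSet_of_hasDerivAt (H : Subgroup (GL (Fin N) ℂ))
    (hH : IsCompact (H : Set (GL (Fin N) ℂ))) {γ : ℝ → GL (Fin N) ℂ}
    (hγH : ∀ t, γ t ∈ H) (h0 : γ 0 = 1) {X : Matrix (Fin N) (Fin N) ℂ}
    (hγ : HasDerivAt (fun t => (γ t : Matrix (Fin N) (Fin N) ℂ)) X 0) : X ∈ lieSet H := by
  rcases N.eq_zero_or_pos with rfl | hN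
  · intro t
    have : expGL (t • X) = 1 := by ext1; exact Subsingleton.elim _ _
    rw [this]; exact H.one_mem
  have : Nonempty (Fin N) := ⟨⟨0, hN⟩⟩
  let _ : NormedRing (Matrix (Fin N) (Fin N) ℂ) := Matrix.linftyOpNormedRing
  let _ : NormedAlgebra ℝ (Matrix (Fin N) (Fin N) ℂ) := Matrix.linftyOpNormedAlgebra
  have _ : NormOneClass (Matrix (Fin N) (Fin N) ℂ) := Matrix.linfty_opNormOneClass
  intro t
  have hd : HasDerivAt (fun s : ℝ => (γ (t * s) : Matrix (Fin N) (Fin N) ℂ)) (t • X) 0 := by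
    have h1 : HasDerivAt (fun s : ℝ => t * s) t 0 := by simpa using (hasDerivAt_id (0 : ℝ)).const_mul t
    have h2 : HasDerivAt (fun t => (γ t : Matrix (Fin N) (Fin N) ℂ)) X (t * 0) := by simpa using hγ
    exact h2.scomp (0 : ℝ) h1
  have hlim := tendsto_pow_exp (γ := fun s : ℝ => (γ (t * s) : Matrix (Fin N) (Fin N) ℂ))
    (by simp [h0]) hd
  have hcl : IsClosed ((fun g : GL (Fin N) ℂ => (g : Matrix (Fin N) (Fin N) ℂ)) '' (H : Set _)) :=
    (hH.image Units.continuous_val).isClosed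
  have hmem := hcl.mem_of_tendsto hlim (Eventually.of_forall fun n =>
    ⟨γ (t * (n : ℝ)⁻¹) ^ n, H.pow_mem (hγH _) n, by simp⟩)
  obtain ⟨h, hhH, hh⟩ := hmem
  have : expGL (t • X) = h := by ext1; exact hh.symm
  rw [this]; exact hhH

lemma add_mem_lieSet (H : Subgroup (GL (Fin N) ℂ)) (hH : IsCompact (H : Set (GL (Fin N) ℂ)))
    {X Y : Matrix (Fin N) (Fin N) ℂ} (hX : X ∈ lieSet H) (hY : Y ∈ lieSet H) :
    X + Y ∈ lieSet H := by
  refine mem_lieSet_of_hasDerivAt H hH (γ := fun t => expGL (t • X) * expGL (t • Y))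
    (fun t => H.mul_mem (hX t) (hY t)) (by simp [expGL_zero]) ?_
  let _ : NormedRing (Matrix (Fin N) (Fin N) ℂ) := Matrix.linftyOpNormedRing
  let _ : NormedAlgebra ℝ (Matrix (Fin N) (Fin N) ℂ) := Matrix.linftyOpNormedAlgebra
  have := HasDerivAt.mul (hasDerivAt_expGL X 0) (hasDerivAt_expGL Y 0)
  simpa [expGL_zero] using! this

lemma smul_mem_lieSet (H : Subgroup (GL (Fin N) ℂ)) (c : ℝ)
    {X : Matrix (Fin N) (Fin N) ℂ} (hX : X ∈ lieSet H) : c • X ∈ lieSet H := by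
  intro t
  rw [smul_smul]; exact hX _

lemma conj_mem_lieSet {H : Subgroup (GL (Fin N) ℂ)} {g : GL (Fin N) ℂ} (hg : g ∈ H)
    {X : Matrix (Fin N) (Fin N) ℂ} (hX : X ∈ lieSet H) :
    (g : Matrix (Fin N) (Fin N) ℂ) * X *
      ((g⁻¹ : GL (Fin N) ℂ) : Matrix (Fin N) (Fin N) ℂ) ∈ lieSet H := by
  intro t
  have := H.mul_mem (H.mul_mem hg (hX t)) (H.inv_mem hg)
  rwa [← expGL_conj, Matrix.mul_smul, Matrix.smul_mul] at this

/-- The Lie algebra as a real vector space of matrices. -/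
def lieSubmodule (H : Subgroup (GL (Fin N) ℂ)) (hH : IsCompact (H : Set (GL (Fin N) ℂ))) :
    Submodule ℝ (Matrix (Fin N) (Fin N) ℂ) where
  carrier := lieSet H
  add_mem' := add_mem_lieSet H hH
  zero_mem' t := by rw [smul_zero, expGL_zero]; exact H.one_mem
  smul_mem' c _ hX := smul_mem_lieSet H c hX

lemma lie_mem_lieSubmodule (H : Subgroup (GL (Fin N) ℂ))
    (hH : IsCompact (H : Set (GL (Fin N) ℂ))) {X Y : Matrix (Fin N) (Fin N) ℂ}
    (hX : X ∈ lieSubmodule H hH) (hY : Y ∈ lieSubmodule H hH) : ⁅X, Y⁆ ∈ lieSubmodule H hH := by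
  let _ : NormedRing (Matrix (Fin N) (Fin N) ℂ) := Matrix.linftyOpNormedRing
  let _ : NormedAlgebra ℝ (Matrix (Fin N) (Fin N) ℂ) := Matrix.linftyOpNormedAlgebra
  set c : ℝ → Matrix (Fin N) (Fin N) ℂ := fun t =>
    (expGL (t • X) : Matrix (Fin N) (Fin N) ℂ) * Y * (expGL (t • -X)) with hc
  have hinv : ∀ t : ℝ, expGL (t • -X) = (expGL (t • X))⁻¹ := by
    intro t; ext1; rw [smul_neg]; rfl
  have hcm : ∀ t, c t ∈ lieSubmodule H hH := fun t => by
    simp only [hc, hinv]; exact conj_mem_lieSet (hX t) hY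
  have hd : HasDerivAt c ⁅X, Y⁆ 0 := by
    have : HasDerivAt c _ 0 :=
      HasDerivAt.mul (HasDerivAt.mul_const (hasDerivAt_expGL X 0) Y) (hasDerivAt_expGL (-X) 0)
    convert this using 1
    simp [expGL_zero, Ring.lie_def, sub_eq_add_neg]
  have hcl : IsClosed ((lieSubmodule H hH : Submodule ℝ _) : Set (Matrix (Fin N) (Fin N) ℂ)) :=
    Submodule.closed_of_finiteDimensional _
  have hs := hd.tendsto_slope
  refine hcl.mem_of_tendsto hs (Eventually.of_forall fun t => ?_)
  exact (lieSubmodule H hH).smul_mem _ ((lieSubmodule H hH).sub_mem (hcm _) (hcm _))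

/-- The (real) Lie algebra of a compact matrix group: all matrices `X` with `exp(tX)` in the
group for every real `t`, with the commutator bracket. -/
def lieAlg (H : Subgroup (GL (Fin N) ℂ)) (hH : IsCompact (H : Set (GL (Fin N) ℂ))) :
    LieSubalgebra ℝ (Matrix (Fin N) (Fin N) ℂ) where
  toSubmodule := lieSubmodule H hH
  lie_mem' := lie_mem_lieSubmodule H hH

/-- For a subgroup `G` of `H`, the Lie algebra of `G` as a subspace of the Lie algebra of `H`. -/
def subLie (H : Subgroup (GL (Fin N) ℂ)) (hH : IsCompact (H : Set (GL (Fin N) ℂ)))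
    (G : Subgroup (GL (Fin N) ℂ)) (hG : IsCompact (G : Set (GL (Fin N) ℂ))) :
    LieSubalgebra ℝ (lieAlg H hH) :=
  (lieAlg G hG).comap (lieAlg H hH).incl

/-- The Killing scalar product `⟨X, Y⟩ = - tr (ad X ∘ ad Y)` on the real Lie algebra of `H`
(positive definite when `H` is compact and its Lie algebra is simple). -/
def killingScalar (H : Subgroup (GL (Fin N) ℂ)) (hH : IsCompact (H : Set (GL (Fin N) ℂ))) :
    LinearMap.BilinForm ℝ (lieAlg H hH) :=
  -killingForm ℝ (lieAlg H hH)

/-- The orthogonal complement of the Lie algebra of `G` in that of `H`. -/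
def lieCompl (H : Subgroup (GL (Fin N) ℂ)) (hH : IsCompact (H : Set (GL (Fin N) ℂ)))
    (G : Subgroup (GL (Fin N) ℂ)) (hG : IsCompact (G : Set (GL (Fin N) ℂ))) :
    Submodule ℝ (lieAlg H hH) :=
  (killingScalar H hH).orthogonal (subLie H hH G hG).toSubmodule

/-- The adjoint action of an element of `H` on the Lie algebra of `H`. -/
def Ad (H : Subgroup (GL (Fin N) ℂ)) (hH : IsCompact (H : Set (GL (Fin N) ℂ))) (h : H) :
    lieAlg H hH →ₗ[ℝ] lieAlg H hH where
  toFun X := ⟨((h : GL (Fin N) ℂ) : Matrix (Fin N) (Fin N) ℂ) * X *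
    (((h : GL (Fin N) ℂ)⁻¹ : GL (Fin N) ℂ) : Matrix (Fin N) (Fin N) ℂ), conj_mem_lieSet h.2 X.2⟩
  map_add' X Y := by ext1; simp [Matrix.mul_add, Matrix.add_mul]
  map_smul' c X := by ext1; simp

/-! ### The Hopf algebra of polynomial functions -/

/-- The *-algebra of polynomial functions on a matrix group: the unital *-algebra of complex
functions generated by the matrix entries (involution: complex conjugation of values). -/
abbrev Pol (G : Subgroup (GL (Fin N) ℂ)) : StarSubalgebra ℂ (G → ℂ) :=
  StarAlgebra.adjoin ℂ {f | ∃ i j : Fin N, f = fun g : G => ((g : GL (Fin N) ℂ) : Matrix (Fin N) (Fin N) ℂ) i j}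

/-- A tensor in `Pol G ⊗ Pol G`, read as a function on `G × G`. -/
def tensorEval (G : Subgroup (GL (Fin N) ℂ)) : Pol G ⊗[ℂ] Pol G →ₐ[ℂ] (G × G → ℂ) :=
  Algebra.TensorProduct.productMap
    (AlgHom.pi fun p : G × G => (Pi.evalAlgHom ℂ (fun _ : G => ℂ) p.1).comp (Pol G).subtype.toAlgHom)
    (AlgHom.pi fun p : G × G => (Pi.evalAlgHom ℂ (fun _ : G => ℂ) p.2).comp (Pol G).subtype.toAlgHom)

lemma tensorEval_tmul (G : Subgroup (GL (Fin N) ℂ)) (a b : Pol G) (p : G × G) :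
    tensorEval G (a ⊗ₜ b) p = a.1 p.1 * b.1 p.2 := by
  simp [tensorEval]

lemma tensorEval_injective (G : Subgroup (GL (Fin N) ℂ)) :
    Function.Injective (tensorEval G) := by
  rw [injective_iff_map_eq_zero]
  intro t ht
  let e := Module.Basis.ofVectorSpace ℂ (Pol G)
  obtain ⟨c, rfl⟩ := TensorProduct.eq_repr_basis_right e t
  have hc : c = 0 := by
    ext i g
    have h2 : ∑ i ∈ c.support, (c i).1 g • e i = 0 := by
      ext h
      have := congrFun ht (g, h)
      simp only [Finsupp.sum, map_sum, Finset.sum_apply, tensorEval_tmul] at this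
      simpa using this
    by_cases hi : i ∈ c.support
    · simpa using linearIndependent_iff'.1 e.linearIndependent _ _ h2 i hi
    · simp [Finsupp.notMem_support_iff.1 hi]
  simp [hc]

lemma tensorEval_star (G : Subgroup (GL (Fin N) ℂ)) (t : Pol G ⊗[ℂ] Pol G) :
    tensorEval G (star t) = star (tensorEval G t) := by
  induction t with
  | zero => simp
  | tmul a b => ext p; simp [tensorEval_tmul]
  | add x y hx hy => simp [hx, hy]

/-- `a ↦ ((g, h) ↦ a (g h))`. -/
def mulPullback (G : Subgroup (GL (Fin N) ℂ)) : Pol G →ₐ[ℂ] (G × G → ℂ) :=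
  AlgHom.pi fun p : G × G => (Pi.evalAlgHom ℂ (fun _ : G => ℂ) (p.1 * p.2)).comp
    (Pol G).subtype.toAlgHom

lemma mulPullback_apply (G : Subgroup (GL (Fin N) ℂ)) (a : Pol G) (p : G × G) :
    mulPullback G a p = a.1 (p.1 * p.2) := rfl

lemma mulPullback_mem (G : Subgroup (GL (Fin N) ℂ)) (a : Pol G) :
    mulPullback G a ∈ (tensorEval G).range := by
  induction a using StarAlgebra.adjoin_induction_subtype with
  | mem x h =>
    obtain ⟨i, j, rfl⟩ := h
    refine ⟨∑ k, (⟨_, StarAlgebra.subset_adjoin _ _ ⟨i, k, rfl⟩⟩ : Pol G) ⊗ₜ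
      (⟨_, StarAlgebra.subset_adjoin _ _ ⟨k, j, rfl⟩⟩ : Pol G), ?_⟩
    ext p
    simp [tensorEval_tmul, mulPullback_apply, Matrix.mul_apply]
  | algebraMap r => rw [AlgHom.commutes]; exact Subalgebra.algebraMap_mem _ r
  | add x y hx hy => rw [map_add]; exact add_mem hx hy
  | mul x y hx hy => rw [map_mul]; exact mul_mem hx hy
  | star x hx =>
    obtain ⟨t, ht⟩ := hx
    refine ⟨star t, ?_⟩
    ext p
    have := congrFun ht p
    simp only [RingHom.coe_coe, AlgHom.toRingHom_eq_coe] at this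
    simp [tensorEval_star, mulPullback_apply, this]

/-- The coproduct of `Pol G`: the algebra map dual to the group multiplication. -/
def comul (G : Subgroup (GL (Fin N) ℂ)) : Pol G →ₐ[ℂ] Pol G ⊗[ℂ] Pol G :=
  ((AlgEquiv.ofInjective (tensorEval G) (tensorEval_injective G)).symm : _ →ₐ[ℂ] _).comp
    ((mulPullback G).codRestrict _ (mulPullback_mem G))

/-- The coproduct is characterised by `φ(a)(g, h) = a (g h)`. -/
lemma tensorEval_comul (G : Subgroup (GL (Fin N) ℂ)) (a : Pol G) (g h : G) :
    tensorEval G (comul G a) (g, h) = a.1 (g * h) := by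
  have : ((AlgEquiv.ofInjective (tensorEval G) (tensorEval_injective G))
      (comul G a)).1 = mulPullback G a := by
    simp [comul]
  exact congrFun this (g, h)

/-- The counit of `Pol G`: evaluation at the neutral element. -/
def counit (G : Subgroup (GL (Fin N) ℂ)) : Pol G →ₐ[ℂ] ℂ :=
  (Pi.evalAlgHom ℂ (fun _ : G => ℂ) 1).comp (Pol G).subtype.toAlgHom

/-- The restriction map `j : Pol H → Pol G` for a subgroup `G ≤ H`. -/
def restrict {G H : Subgroup (GL (Fin N) ℂ)} (hGH : G ≤ H) : Pol H →⋆ₐ[ℂ] Pol G where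
  toFun a := ⟨fun g => a.1 (Subgroup.inclusion hGH g), by
    induction a using StarAlgebra.adjoin_induction_subtype with
    | mem x h =>
      obtain ⟨i, j, rfl⟩ := h
      exact StarAlgebra.subset_adjoin _ _ ⟨i, j, rfl⟩
    | algebraMap r => exact algebraMap_mem (Pol G) r
    | add x y hx hy => exact add_mem hx hy
    | mul x y hx hy => exact mul_mem hx hy
    | star x hx => exact star_mem hx⟩
  map_one' := rfl
  map_mul' _ _ := rfl
  map_zero' := rfl
  map_add' _ _ := rfl
  commutes' _ := rfl
  map_star' _ := rfl

/-! ### Tangent functionals -/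

lemma differentiableAt_pol {H : Subgroup (GL (Fin N) ℂ)} {X : Matrix (Fin N) (Fin N) ℂ}
    (hX : X ∈ lieSet H) (a : Pol H) (t : ℝ) :
    DifferentiableAt ℝ (fun s : ℝ => a.1 ⟨expGL (s • X), hX s⟩) t := by
  induction a using StarAlgebra.adjoin_induction_subtype with
  | mem x h =>
    obtain ⟨i, j, rfl⟩ := h
    exact (hasDerivAt_pi.1 (hasDerivAt_pi.1 (hasDerivAt_expGL X t) i) j).differentiableAt
  | algebraMap r => exact differentiableAt_const r
  | add x y hx hy => exact hx.add hy
  | mul x y hx hy => exact hx.mul hy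
  | star x hx => exact hx.star

/-- An element `X` of the real Lie algebra of `H` as a linear functional on polynomial functions:
`a ↦ d/dt a(exp(tX))` at `t = 0`. -/
def tangent {H : Subgroup (GL (Fin N) ℂ)} {hH : IsCompact (H : Set (GL (Fin N) ℂ))}
    (X : lieAlg H hH) : Pol H →ₗ[ℂ] ℂ where
  toFun a := deriv (fun t : ℝ => a.1 ⟨expGL (t • (X : Matrix (Fin N) (Fin N) ℂ)), X.2 t⟩) 0
  map_add' a b := deriv_add (differentiableAt_pol X.2 a 0) (differentiableAt_pol X.2 b 0)
  map_smul' c a := deriv_const_smul c (differentiableAt_pol X.2 a 0)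

/-! ### The matrix of the adjoint representation -/

lemma norm_det_le_one {G : Subgroup (GL (Fin N) ℂ)} (hG : IsCompact (G : Set (GL (Fin N) ℂ)))
    {g : GL (Fin N) ℂ} (hg : g ∈ G) : ‖(g : Matrix (Fin N) (Fin N) ℂ).det‖ ≤ 1 := by
  have hc : Continuous fun h : GL (Fin N) ℂ => ‖(h : Matrix (Fin N) (Fin N) ℂ).det‖ :=
    (Continuous.matrix_det Units.continuous_val).norm
  obtain ⟨C, hC⟩ := (hG.image hc).bddAbove
  by_contra! hlt
  obtain ⟨n, hn⟩ := pow_unbounded_of_one_lt C hlt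
  have := hC ⟨g ^ n, G.pow_mem hg n, rfl⟩
  simp only [Units.val_pow_eq_pow_val, Matrix.det_pow, norm_pow] at this
  linarith

lemma norm_det_eq_one {G : Subgroup (GL (Fin N) ℂ)} (hG : IsCompact (G : Set (GL (Fin N) ℂ)))
    {g : GL (Fin N) ℂ} (hg : g ∈ G) : ‖(g : Matrix (Fin N) (Fin N) ℂ).det‖ = 1 := by
  refine le_antisymm (norm_det_le_one hG hg) ?_
  have h1 := norm_det_le_one hG (G.inv_mem hg)
  have h2 : ‖(g : Matrix (Fin N) (Fin N) ℂ).det‖ *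
      ‖((g⁻¹ : GL (Fin N) ℂ) : Matrix (Fin N) (Fin N) ℂ).det‖ = 1 := by
    rw [← norm_mul, ← Matrix.det_mul, ← Units.val_mul]; simp
  nlinarith [norm_nonneg (g : Matrix (Fin N) (Fin N) ℂ).det]

lemma entry_mem (G : Subgroup (GL (Fin N) ℂ)) (i j : Fin N) :
    (fun g : G => ((g : GL (Fin N) ℂ) : Matrix (Fin N) (Fin N) ℂ) i j) ∈ Pol G :=
  StarAlgebra.subset_adjoin _ _ ⟨i, j, rfl⟩

lemma det_mem {G : Subgroup (GL (Fin N) ℂ)} {M : G → Matrix (Fin N) (Fin N) ℂ}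
    (hM : ∀ i j, (fun g => M g i j) ∈ Pol G) : (fun g => (M g).det) ∈ Pol G := by
  have : (fun g => (M g).det) = ∑ σ : Equiv.Perm (Fin N), ((Equiv.Perm.sign σ : ℤ) : ℂ) •
      ∏ i, fun g => M g (σ i) i := by
    ext g; simp [Matrix.det_apply']
  rw [this]
  exact sum_mem fun σ _ => SMulMemClass.smul_mem _ (prod_mem fun i _ => hM _ _)

lemma inv_entry_mem {G : Subgroup (GL (Fin N) ℂ)} (hG : IsCompact (G : Set (GL (Fin N) ℂ)))
    (i j : Fin N) : (fun g : G =>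
      (((g : GL (Fin N) ℂ)⁻¹ : GL (Fin N) ℂ) : Matrix (Fin N) (Fin N) ℂ) i j) ∈ Pol G := by
  have h1 : (fun g : G => ((g : GL (Fin N) ℂ) : Matrix (Fin N) (Fin N) ℂ).det) ∈ Pol G :=
    det_mem (entry_mem G)
  have h2 : (fun g : G => ((g : GL (Fin N) ℂ) : Matrix (Fin N) (Fin N) ℂ).adjugate i j) ∈ Pol G := by
    simp only [Matrix.adjugate_apply]
    refine det_mem fun k l => ?_
    by_cases hk : k = j
    · subst hk
      simp only [Matrix.updateRow_self]
      exact algebraMap_mem (Pol G) ((Pi.single i 1 : Fin N → ℂ) l)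
    · simpa [Matrix.updateRow_ne hk] using entry_mem G k l
  convert mul_mem (star_mem h1) h2 using 1
  ext g
  have hd := norm_det_eq_one hG g.2
  have hinv : (((g : GL (Fin N) ℂ) : Matrix (Fin N) (Fin N) ℂ).det)⁻¹ =
      star (((g : GL (Fin N) ℂ) : Matrix (Fin N) (Fin N) ℂ).det) := by
    rw [Complex.star_def, Complex.inv_def, Complex.normSq_eq_norm_sq, hd]; simp
  rw [Matrix.coe_units_inv, Matrix.inv_def, Ring.inverse_eq_inv', hinv]
  simp

lemma re_mem {G : Subgroup (GL (Fin N) ℂ)} {f : G → ℂ} (hf : f ∈ Pol G) :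
    (fun g => ((f g).re : ℂ)) ∈ Pol G := by
  have : (fun g => ((f g).re : ℂ)) = (2⁻¹ : ℂ) • (f + star f) := by
    ext g; simp [Complex.add_conj]
  rw [this]
  exact SMulMemClass.smul_mem _ (add_mem hf (star_mem hf))

lemma im_mem {G : Subgroup (GL (Fin N) ℂ)} {f : G → ℂ} (hf : f ∈ Pol G) :
    (fun g => ((f g).im : ℂ)) ∈ Pol G := by
  have : (fun g => ((f g).im : ℂ)) = fun g => ((((-Complex.I) • f) g).re : ℂ) := by
    ext g; simp
  rw [this]
  exact re_mem (SMulMemClass.smul_mem _ hf)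

lemma real_linear_mem {G : Subgroup (GL (Fin N) ℂ)} {M : G → Matrix (Fin N) (Fin N) ℂ}
    (hM : ∀ i j, (fun g => M g i j) ∈ Pol G) (L : Matrix (Fin N) (Fin N) ℂ →ₗ[ℝ] ℝ) :
    (fun g => (L (M g) : ℂ)) ∈ Pol G := by
  have : (fun g => (L (M g) : ℂ)) = ∑ i, ∑ j,
      ((L (Matrix.single i j 1) : ℂ) • (fun g => ((M g i j).re : ℂ)) +
        (L (Matrix.single i j Complex.I) : ℂ) • (fun g => ((M g i j).im : ℂ))) := by
    ext g
    have h1 : M g = ∑ i, ∑ j, ((M g i j).re • Matrix.single i j (1 : ℂ) +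
        (M g i j).im • Matrix.single i j Complex.I) := by
      conv_lhs => rw [Matrix.matrix_eq_sum_single (M g)]
      refine Finset.sum_congr rfl fun i _ => Finset.sum_congr rfl fun j _ => ?_
      rw [Matrix.smul_single, Matrix.smul_single, ← Matrix.single_add]
      congr 1
      simp [Complex.re_add_im]
    conv_lhs => rw [h1]
    simp only [map_sum, map_add, map_smul, Finset.sum_apply, Pi.add_apply, Pi.smul_apply,
      smul_eq_mul, Complex.ofReal_sum, Complex.ofReal_add, Complex.ofReal_mul]
    refine Finset.sum_congr rfl fun i _ => Finset.sum_congr rfl fun j _ => by ring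
  rw [this]
  exact sum_mem fun i _ => sum_mem fun j _ =>
    add_mem (SMulMemClass.smul_mem _ (re_mem (hM i j))) (SMulMemClass.smul_mem _ (im_mem (hM i j)))

lemma ad_coeff_mem {G H : Subgroup (GL (Fin N) ℂ)} (hH : IsCompact (H : Set (GL (Fin N) ℂ)))
    (hG : IsCompact (G : Set (GL (Fin N) ℂ))) (hGH : G ≤ H)
    (X Y : lieAlg H hH) :
    (fun g : G => ((killingScalar H hH X (Ad H hH (Subgroup.inclusion hGH g) Y) : ℝ) : ℂ)) ∈
      Pol G := by
  obtain ⟨L, hL⟩ := LinearMap.exists_extend (p := (lieAlg H hH).toSubmodule) (killingScalar H hH X)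
  have : (fun g : G => ((killingScalar H hH X (Ad H hH (Subgroup.inclusion hGH g) Y) : ℝ) : ℂ)) =
      fun g : G => (L (((g : GL (Fin N) ℂ) : Matrix (Fin N) (Fin N) ℂ) * Y *
        (((g : GL (Fin N) ℂ)⁻¹ : GL (Fin N) ℂ) : Matrix (Fin N) (Fin N) ℂ)) : ℂ) := by
    ext g
    rw [← hL]; rfl
  rw [this]
  refine real_linear_mem (fun i j => ?_) L
  have e : (fun g : G => (((g : GL (Fin N) ℂ) : Matrix (Fin N) (Fin N) ℂ) * Y *
        (((g : GL (Fin N) ℂ)⁻¹ : GL (Fin N) ℂ) : Matrix (Fin N) (Fin N) ℂ)) i j) =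
      ∑ k, ∑ l, ((Y : Matrix (Fin N) (Fin N) ℂ) l k) •
        ((fun g : G => ((g : GL (Fin N) ℂ) : Matrix (Fin N) (Fin N) ℂ) i l) *
        (fun g : G => (((g : GL (Fin N) ℂ)⁻¹ : GL (Fin N) ℂ) : Matrix (Fin N) (Fin N) ℂ) k j)) := by
    ext g
    simp only [Matrix.mul_apply, Finset.sum_apply, Pi.smul_apply, Pi.mul_apply, smul_eq_mul,
      Finset.sum_mul]
    refine Finset.sum_congr rfl fun k _ => Finset.sum_congr rfl fun l _ => by ring
  rw [e]
  exact sum_mem fun k _ => sum_mem fun l _ =>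
    SMulMemClass.smul_mem _ (mul_mem (entry_mem G i l) (inv_entry_mem hG k j))

/-- `ξ` is a (real) orthonormal basis of the orthogonal complement of the Lie algebra of `G` in
the Lie algebra of `H`, with respect to the Killing scalar product. -/
structure IsOrthonormalBasisCompl (H : Subgroup (GL (Fin N) ℂ))
    (hH : IsCompact (H : Set (GL (Fin N) ℂ))) (G : Subgroup (GL (Fin N) ℂ))
    (hG : IsCompact (G : Set (GL (Fin N) ℂ))) {n : ℕ} (ξ : Fin n → lieAlg H hH) : Prop where
  orthonormal : ∀ i j, killingScalar H hH (ξ i) (ξ j) = if i = j then 1 else 0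
  span_eq : Submodule.span ℝ (Set.range ξ) = lieCompl H hH G hG

/-- Matrix elements `u j i (g) = ⟨ξ j, Ad g (ξ i)⟩` of the adjoint action of `G`, relative to an
orthonormal system `ξ`; thus `Ad g (ξ i) = ∑ j, u j i (g) ξ j` for an orthonormal basis of an
invariant subspace. -/
def adjointRep {G H : Subgroup (GL (Fin N) ℂ)} (hH : IsCompact (H : Set (GL (Fin N) ℂ)))
    (hG : IsCompact (G : Set (GL (Fin N) ℂ))) (hGH : G ≤ H) {n : ℕ} (ξ : Fin n → lieAlg H hH) :
    Matrix (Fin n) (Fin n) (Pol G) := fun j i =>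
  ⟨fun g => ((killingScalar H hH (ξ j) (Ad H hH (Subgroup.inclusion hGH g) (ξ i)) : ℝ) : ℂ),
    ad_coeff_mem hH hG hGH (ξ j) (ξ i)⟩

/-! ### Actions on quantum spaces, quantum principal bundles, frame structures -/

section Bundles

variable {V B : Type*} [Ring V] [StarRing V] [Algebra ℂ V] [StarModule ℂ V]
  [Ring B] [StarRing B] [Algebra ℂ B] [StarModule ℂ B]

/-- A (dualized, right) action of the group `G` on the quantum space with function *-algebra `B`:
a *-homomorphism `F : B → B ⊗ Pol G` with `(F ⊗ id) F = (id ⊗ φ) F` and `(id ⊗ ε) F = id`. -/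
structure IsAction (G : Subgroup (GL (Fin N) ℂ)) (F : B →⋆ₐ[ℂ] B ⊗[ℂ] Pol G) : Prop where
  coassoc : ∀ b, TensorProduct.assoc ℂ B (Pol G) (Pol G)
    (TensorProduct.map F.toAlgHom.toLinearMap LinearMap.id (F b)) =
      TensorProduct.map LinearMap.id (comul G).toLinearMap (F b)
  counit : ∀ b, TensorProduct.rid ℂ B
    (TensorProduct.map LinearMap.id (counit G).toLinearMap (F b)) = b

/-- The action is free: every `1 ⊗ a` has the form `∑ₖ bₖ F(qₖ)`. -/
def IsFree (G : Subgroup (GL (Fin N) ℂ)) (F : B →⋆ₐ[ℂ] B ⊗[ℂ] Pol G) : Prop :=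
  ∀ a : Pol G, ∃ (m : ℕ) (b q : Fin m → B),
    ∑ k, (b k ⊗ₜ[ℂ] (1 : Pol G)) * F (q k) = 1 ⊗ₜ[ℂ] a

/-- The triple `(B, i, F)` is a quantum principal `G`-bundle over the quantum space given by `V`:
`F` is a free action and `i` identifies `V` with the *-algebra of `F`-fixed elements. -/
structure IsQuantumPrincipalBundle (G : Subgroup (GL (Fin N) ℂ)) (i : V →⋆ₐ[ℂ] B)
    (F : B →⋆ₐ[ℂ] B ⊗[ℂ] Pol G) : Prop where
  injective : Function.Injective i
  mem_range_iff : ∀ b, b ∈ Set.range i ↔ F b = b ⊗ₜ[ℂ] (1 : Pol G)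
  action : IsAction G F
  free : IsFree G F

/-- Hermitian derivations `V → B` relative to a *-homomorphism `i : V → B`. -/
structure IsHermitianDerivation (i : V →⋆ₐ[ℂ] B) (D : V →ₗ[ℂ] B) : Prop where
  leibniz : ∀ f g, D (f * g) = D f * i g + i f * D g
  hermitian : ∀ f, D (star f) = star (D f)

/-- The kernel of a matrix representation. -/
def repKernel (G : Subgroup (GL (Fin N) ℂ)) {n : ℕ} (u : Matrix (Fin n) (Fin n) (Pol G)) :
    Set G :=
  {g | ∀ i j, (u i j).1 g = if i = j then 1 else 0}

/-- `u` is the matrix of a real unitary representation of `G` in `ℂⁿ` with discrete kernel. -/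
structure IsRealUnitaryRep (G : Subgroup (GL (Fin N) ℂ)) {n : ℕ}
    (u : Matrix (Fin n) (Fin n) (Pol G)) : Prop where
  comul : ∀ i j, comul G (u i j) = ∑ k, u i k ⊗ₜ[ℂ] u k j
  counit : ∀ i j, counit G (u i j) = if i = j then 1 else 0
  real : ∀ i j, star (u i j) = u i j
  unitary : u ∈ Matrix.unitaryGroup (Fin n) (Pol G)
  discrete_kernel : DiscreteTopology (repKernel G u)

/-- `τ = (∂₁, …, ∂ₙ)` is a frame structure on the quantum principal bundle `(B, i, F)`, relative
to the representation `u`. -/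
structure IsFrameStructure (G : Subgroup (GL (Fin N) ℂ)) (i : V →⋆ₐ[ℂ] B)
    (F : B →⋆ₐ[ℂ] B ⊗[ℂ] Pol G) {n : ℕ} (u : Matrix (Fin n) (Fin n) (Pol G))
    (τ : Fin n → V →ₗ[ℂ] B) : Prop where
  bundle : IsQuantumPrincipalBundle G i F
  rep : IsRealUnitaryRep G u
  derivation : ∀ k, IsHermitianDerivation i (τ k)
  covariant : ∀ k f, F (τ k f) = ∑ j, τ j f ⊗ₜ[ℂ] u j k
  complete : ∃ (d : ℕ) (b : Fin n → Fin d → B) (v : Fin n → Fin d → V),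
    ∀ k j, ∑ α, b k α * τ j (v k α) = if k = j then 1 else 0

/-- The system `X = (X₁, …, Xₙ)` of hermitian derivations of `B` is an extension of `τ`:
`F X_j = ∑ₖ (X_k ⊗ u_{kj}) F`, `X_j` restricts to `∂_j`, and `X_j ∂_k = X_k ∂_j`. -/
structure IsFrameExtension (G : Subgroup (GL (Fin N) ℂ)) (i : V →⋆ₐ[ℂ] B)
    (F : B →⋆ₐ[ℂ] B ⊗[ℂ] Pol G) {n : ℕ} (u : Matrix (Fin n) (Fin n) (Pol G))
    (τ : Fin n → V →ₗ[ℂ] B) (X : Fin n → B →ₗ[ℂ] B) : Prop where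
  derivation : ∀ j, IsHermitianDerivation (StarAlgHom.id ℂ B) (X j)
  covariant : ∀ j b, F (X j b) =
    ∑ k, TensorProduct.map (X k) (LinearMap.mulLeft ℂ (u k j)) (F b)
  restricts : ∀ j f, X j (i f) = τ j f
  torsion_free : ∀ j k f, X j (τ k f) - X k (τ j f) = 0

/-- Integrable frame structures. -/
def IsIntegrableFrameStructure (G : Subgroup (GL (Fin N) ℂ)) (i : V →⋆ₐ[ℂ] B)
    (F : B →⋆ₐ[ℂ] B ⊗[ℂ] Pol G) {n : ℕ} (u : Matrix (Fin n) (Fin n) (Pol G))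
    (τ : Fin n → V →ₗ[ℂ] B) : Prop :=
  IsFrameStructure G i F u τ ∧ ∃ X : Fin n → B →ₗ[ℂ] B, IsFrameExtension G i F u τ X

/-- The restriction `F = (id ⊗ j) F⋆` of an action of `H` to a subgroup `G`. -/
def restrictAction {G H : Subgroup (GL (Fin N) ℂ)} (hGH : G ≤ H)
    (Fs : B →⋆ₐ[ℂ] B ⊗[ℂ] Pol H) : B →⋆ₐ[ℂ] B ⊗[ℂ] Pol G where
  toAlgHom := (Algebra.TensorProduct.map (AlgHom.id ℂ B) (restrict hGH).toAlgHom).comp Fs.toAlgHom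
  map_star' b := by
    have h : ∀ t : B ⊗[ℂ] Pol H,
        Algebra.TensorProduct.map (AlgHom.id ℂ B) (restrict hGH).toAlgHom (star t) =
          star (Algebra.TensorProduct.map (AlgHom.id ℂ B) (restrict hGH).toAlgHom t) := by
      intro t
      induction t with
      | zero => simp
      | tmul b a => simp; rfl
      | add x y hx hy => simp only [star_add, map_add, hx, hy]
    have := h (Fs b)
    rw [← map_star] at this
    exact this

/-- The *-subalgebra of elements fixed by an action. -/
def fixedSubalgebra (G : Subgroup (GL (Fin N) ℂ)) (F : B →⋆ₐ[ℂ] B ⊗[ℂ] Pol G) :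
    StarSubalgebra ℂ B where
  carrier := {b | F b = b ⊗ₜ[ℂ] (1 : Pol G)}
  mul_mem' {a b} ha hb := by
    simp only [Set.mem_ofPred_eq] at *
    rw [map_mul, ha, hb, Algebra.TensorProduct.tmul_mul_tmul, mul_one]
  add_mem' {a b} ha hb := by
    simp only [Set.mem_ofPred_eq] at *
    rw [map_add, ha, hb, TensorProduct.add_tmul]
  algebraMap_mem' r := by
    simp only [Set.mem_ofPred_eq, AlgHomClass.commutes]
    rfl
  star_mem' {a} ha := by
    simp only [Set.mem_ofPred_eq] at *
    rw [map_star, ha, TensorProduct.star_tmul, star_one]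

/-- The operator `X_ξ = (id ⊗ ξ) F⋆` on `B` induced by an element `ξ` of the Lie algebra. -/
def inducedDerivation {H : Subgroup (GL (Fin N) ℂ)} {hH : IsCompact (H : Set (GL (Fin N) ℂ))}
    (Fs : B →⋆ₐ[ℂ] B ⊗[ℂ] Pol H) (ξ : lieAlg H hH) : B →ₗ[ℂ] B :=
  (TensorProduct.rid ℂ B).toLinearMap ∘ₗ TensorProduct.map LinearMap.id (tangent ξ) ∘ₗ
    Fs.toAlgHom.toLinearMap

/-- The restriction `∂_ξ` of `X_ξ` to the *-subalgebra fixed by a subgroup `G`. -/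
def restrictedDerivation {G H : Subgroup (GL (Fin N) ℂ)}
    {hH : IsCompact (H : Set (GL (Fin N) ℂ))} (hGH : G ≤ H)
    (Fs : B →⋆ₐ[ℂ] B ⊗[ℂ] Pol H) (ξ : lieAlg H hH) :
    fixedSubalgebra G (restrictAction hGH Fs) →ₗ[ℂ] B :=
  inducedDerivation Fs ξ ∘ₗ
    (fixedSubalgebra G (restrictAction hGH Fs)).subtype.toAlgHom.toLinearMap

end Bundles

end
end FramedBundle

/-! Everything is expressed through slices (id ⊗ l)F⋆ by functionals l on Pol(H). Coassociativity
turns a composition of slices into the slice by a convolution (`slice_slice`), so statements about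
operators on B become statements about functionals on the group. Elements of 𝔥 give hermitian
functionals obeying the Leibniz rule at 1. Such functionals are determined by the matrix entries
(`IsTangential.ext`), whence the bracket is the convolution commutator (`tangent_lie`) and [X_ξ,
X_η] = X_[ξ,η]. The identity g exp(tξ) = exp(t Ad_g ξ) g gives ev_g ∗ ξ = Ad_g ξ ∗ ev_g, which is
covariance, because tensors in B ⊗ Pol(G) are separated by points of G (`tensor_ext`). The
substantial point is completeness (e). Stone–Weierstrass and Haar averaging show that right
G-invariant polynomials separate G from the other cosets. If a real combination X of the ξ_j kills
all of them, they are constant along exp(tX), so exp(tX) ∈ G and X ∈ 𝔤 ∩ 𝔤^⊥; orthonormality then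
makes all coefficients zero. By duality there is an invariant a with prescribed values ξ_j(a)
(`exists_rightInvariant_tangent`). Freeness writes 1 ⊗ a = ∑ b_α F⋆(q_α); replacing each q_α by its
average over G yields fixed elements v_α, and applying ξ_j gives ∑ b_α ∂_j(v_α) = ξ_j(a)1, since
averaging leaves a unchanged. Integrability follows because X_ζ kills the fixed elements for ζ ∈ 𝔤,
so [X_j, X_k] vanishes on them once [𝔤^⊥, 𝔤^⊥] ⊆ 𝔤. -/

namespace FramedBundle

noncomputable section

variable {N : ℕ}

/-! ### Slice maps and convolution of functionals -/

section Generalities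

variable {M P Q : Type*} [AddCommGroup M] [Module ℂ M] [AddCommGroup P] [Module ℂ P]
  [AddCommGroup Q] [Module ℂ Q]

/-- The functional `l` pairs with the middle leg produced by `f` and `m` with the last leg, so
contracting both at once or one after the other is the same. The second induction is over the tensor
`f x`. -/
lemma slice_assoc_map (f : M →ₗ[ℂ] M ⊗[ℂ] P) (l m : P →ₗ[ℂ] ℂ) (t : M ⊗[ℂ] P) :
    TensorProduct.rid ℂ M (TensorProduct.map LinearMap.id
      (LinearMap.mul' ℂ ℂ ∘ₗ TensorProduct.map l m)
      (TensorProduct.assoc ℂ M P P (TensorProduct.map f LinearMap.id t))) =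
    TensorProduct.rid ℂ M (TensorProduct.map LinearMap.id l
      (f (TensorProduct.rid ℂ M (TensorProduct.map LinearMap.id m t)))) := by
  induction t with
  | zero => simp
  | tmul x a =>
    simp only [TensorProduct.map_tmul, LinearMap.id_apply, TensorProduct.rid_tmul, map_smul]
    induction f x with
    | zero => simp
    | tmul y c => simp [smul_smul, mul_comm]
    | add x y hx hy => simp only [TensorProduct.add_tmul, map_add, hx, hy, smul_add]
  | add x y hx hy => simp only [map_add, hx, hy]

lemma map_assoc_map (f : M →ₗ[ℂ] M ⊗[ℂ] P) (r : P →ₗ[ℂ] Q) (t : M ⊗[ℂ] P) :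
    TensorProduct.assoc ℂ M Q Q (TensorProduct.map (TensorProduct.map LinearMap.id r ∘ₗ f)
      LinearMap.id (TensorProduct.map LinearMap.id r t)) =
    TensorProduct.map LinearMap.id (TensorProduct.map r r)
      (TensorProduct.assoc ℂ M P P (TensorProduct.map f LinearMap.id t)) := by
  induction t with
  | zero => simp
  | tmul x a =>
    simp only [TensorProduct.map_tmul, LinearMap.id_apply, LinearMap.comp_apply]
    induction f x with
    | zero => simp
    | tmul y c => simp
    | add x y hx hy => simp only [TensorProduct.add_tmul, map_add, hx, hy]
  | add x y hx hy => simp only [map_add, hx, hy]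

/-- Source of every convolution identity below: coassociativity at `b` merges two successive slices
into one. -/
lemma slice_slice_of_coassoc (f : M →ₗ[ℂ] M ⊗[ℂ] P) (δ : P →ₗ[ℂ] P ⊗[ℂ] P) {b : M}
    (h : TensorProduct.assoc ℂ M P P (TensorProduct.map f LinearMap.id (f b)) =
      TensorProduct.map LinearMap.id δ (f b)) (l m : P →ₗ[ℂ] ℂ) :
    TensorProduct.rid ℂ M (TensorProduct.map LinearMap.id l
      (f (TensorProduct.rid ℂ M (TensorProduct.map LinearMap.id m (f b))))) =
    TensorProduct.rid ℂ M (TensorProduct.map LinearMap.id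
      (LinearMap.mul' ℂ ℂ ∘ₗ TensorProduct.map l m ∘ₗ δ) (f b)) := by
  rw [← slice_assoc_map, h, ← LinearMap.comp_apply (TensorProduct.map _ _),
    ← TensorProduct.map_comp, LinearMap.id_comp, LinearMap.comp_assoc]

lemma coassoc_restrict (f : M →ₗ[ℂ] M ⊗[ℂ] P) (r : P →ₗ[ℂ] Q) (δ : P →ₗ[ℂ] P ⊗[ℂ] P)
    (δ' : Q →ₗ[ℂ] Q ⊗[ℂ] Q) (hδ : δ' ∘ₗ r = TensorProduct.map r r ∘ₗ δ) {b : M}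
    (h : TensorProduct.assoc ℂ M P P (TensorProduct.map f LinearMap.id (f b)) =
      TensorProduct.map LinearMap.id δ (f b)) :
    TensorProduct.assoc ℂ M Q Q (TensorProduct.map (TensorProduct.map LinearMap.id r ∘ₗ f)
      LinearMap.id (TensorProduct.map LinearMap.id r (f b))) =
    TensorProduct.map LinearMap.id δ' (TensorProduct.map LinearMap.id r (f b)) := by
  have e : ∀ t : M ⊗[ℂ] P,
      TensorProduct.map LinearMap.id (TensorProduct.map r r) (TensorProduct.map LinearMap.id δ t) =
      TensorProduct.map (LinearMap.id : M →ₗ[ℂ] M) δ' (TensorProduct.map LinearMap.id r t) :=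
    fun t => by
      rw [← LinearMap.comp_apply, ← LinearMap.comp_apply, ← TensorProduct.map_comp,
        ← TensorProduct.map_comp, hδ]
  rw [map_assoc_map, h, e]

end Generalities

/-! ### Slices over Pol(G), point evaluations and translations. -/

section Slices

variable {B : Type*} [Ring B] [Algebra ℂ B]

/-- The map `id ⊗ l : B ⊗ Pol G → B` for a linear functional `l`. -/
def slice (B : Type*) [Ring B] [Algebra ℂ B] {G : Subgroup (GL (Fin N) ℂ)} (l : Pol G →ₗ[ℂ] ℂ) :
    B ⊗[ℂ] Pol G →ₗ[ℂ] B :=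
  (TensorProduct.rid ℂ B).toLinearMap ∘ₗ TensorProduct.map LinearMap.id l

@[simp] lemma slice_tmul {G : Subgroup (GL (Fin N) ℂ)} (l : Pol G →ₗ[ℂ] ℂ) (b : B) (a : Pol G) :
    slice B l (b ⊗ₜ a) = l a • b := by
  simp [slice]

lemma slice_map {G H : Subgroup (GL (Fin N) ℂ)} (l : Pol G →ₗ[ℂ] ℂ)
    (f : Pol H →ₗ[ℂ] Pol G) (t : B ⊗[ℂ] Pol H) :
    slice B l (TensorProduct.map LinearMap.id f t) = slice B (l ∘ₗ f) t := by
  induction t with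
  | zero => simp
  | tmul b a => simp
  | add x y hx hy => simp only [map_add, hx, hy]

lemma slice_add {G : Subgroup (GL (Fin N) ℂ)} (l m : Pol G →ₗ[ℂ] ℂ) (t : B ⊗[ℂ] Pol G) :
    slice B (l + m) t = slice B l t + slice B m t := by
  induction t with
  | zero => simp
  | tmul b a => simp [add_smul]
  | add x y hx hy => simp only [map_add, hx, hy]; abel

lemma slice_smul {G : Subgroup (GL (Fin N) ℂ)} (c : ℂ) (l : Pol G →ₗ[ℂ] ℂ)
    (t : B ⊗[ℂ] Pol G) : slice B (c • l) t = c • slice B l t := by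
  induction t with
  | zero => simp
  | tmul b a => simp [smul_smul]
  | add x y hx hy => simp only [map_add, hx, hy, smul_add]

lemma slice_sub {G : Subgroup (GL (Fin N) ℂ)} (l m : Pol G →ₗ[ℂ] ℂ) (t : B ⊗[ℂ] Pol G) :
    slice B (l - m) t = slice B l t - slice B m t := by
  rw [sub_eq_add_neg, ← neg_one_smul ℂ m, slice_add, slice_smul]; simp [sub_eq_add_neg]

lemma slice_sum {G : Subgroup (GL (Fin N) ℂ)} {ι : Type*} (s : Finset ι)
    (l : ι → Pol G →ₗ[ℂ] ℂ) (t : B ⊗[ℂ] Pol G) :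
    slice B (∑ i ∈ s, l i) t = ∑ i ∈ s, slice B (l i) t := by
  classical
  induction s using Finset.induction_on with
  | empty => simpa using slice_smul (0 : ℂ) (0 : Pol G →ₗ[ℂ] ℂ) t
  | insert i s hi ih => rw [Finset.sum_insert hi, Finset.sum_insert hi, slice_add, ih]

/-- Left `B`-linearity of slices; it lets a slice be applied to a freeness identity. -/
lemma slice_tmul_one_mul {G : Subgroup (GL (Fin N) ℂ)} (l : Pol G →ₗ[ℂ] ℂ) (b : B)
    (t : B ⊗[ℂ] Pol G) : slice B l ((b ⊗ₜ 1) * t) = b * slice B l t := by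
  induction t with
  | zero => simp
  | tmul x a => simp
  | add x y hx hy => simp only [mul_add, map_add, hx, hy]

/-- Evaluation of a polynomial function at a point. -/
def evalAt {G : Subgroup (GL (Fin N) ℂ)} (g : G) : Pol G →ₐ[ℂ] ℂ :=
  (Pi.evalAlgHom ℂ (fun _ : G => ℂ) g).comp (Pol G).subtype.toAlgHom

@[simp] lemma evalAt_apply {G : Subgroup (GL (Fin N) ℂ)} (g : G) (a : Pol G) :
    evalAt g a = a.1 g := rfl

/-- Tensors in `B ⊗ Pol G` are separated by evaluations at the points of `G`. -/
lemma tensor_ext {G : Subgroup (GL (Fin N) ℂ)} {s t : B ⊗[ℂ] Pol G}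
    (h : ∀ g, slice B (evalAt g).toLinearMap s = slice B (evalAt g).toLinearMap t) : s = t := by
  rw [← sub_eq_zero]
  have h' : ∀ g, slice B (evalAt g).toLinearMap (s - t) = 0 := fun g => by
    rw [map_sub, h, sub_self]
  generalize s - t = r at h'
  -- In a basis of `B` the coefficients of the tensor are polynomial functions; linear independence
  -- makes each of them vanish at every point.
  let e := Module.Basis.ofVectorSpace ℂ B
  obtain ⟨c, rfl⟩ := TensorProduct.eq_repr_basis_left e r
  have hc : c = 0 := by
    ext i g
    have h2 : ∑ i ∈ c.support, (c i).1 g • e i = 0 := by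
      have := h' g
      simpa only [Finsupp.sum, map_sum, slice_tmul, AlgHom.toLinearMap_apply,
        evalAt_apply] using this
    by_cases hi : i ∈ c.support
    · simpa using linearIndependent_iff'.1 e.linearIndependent _ _ h2 i hi
    · simp [Finsupp.notMem_support_iff.1 hi]
  simp [hc]

/-- The convolution `(l ⊗ m) φ` of two functionals on `Pol G`. -/
def conv {G : Subgroup (GL (Fin N) ℂ)} (l m : Pol G →ₗ[ℂ] ℂ) : Pol G →ₗ[ℂ] ℂ :=
  LinearMap.mul' ℂ ℂ ∘ₗ TensorProduct.map l m ∘ₗ (comul G).toLinearMap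

/-- The map `(id ⊗ m) φ : Pol G → Pol G`. -/
def convRight {G : Subgroup (GL (Fin N) ℂ)} (m : Pol G →ₗ[ℂ] ℂ) : Pol G →ₗ[ℂ] Pol G :=
  slice (Pol G) m ∘ₗ (comul G).toLinearMap

/-- Left translation `a ↦ a(g ·)`. -/
def leftTranslate {G : Subgroup (GL (Fin N) ℂ)} (g : G) : Pol G →ₗ[ℂ] Pol G :=
  (TensorProduct.lid ℂ (Pol G)).toLinearMap ∘ₗ
    TensorProduct.map (evalAt g).toLinearMap LinearMap.id ∘ₗ (comul G).toLinearMap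

lemma leftTranslate_apply {G : Subgroup (GL (Fin N) ℂ)} (g : G) (a : Pol G) (h : G) :
    (leftTranslate g a).1 h = a.1 (g * h) := by
  rw [← tensorEval_comul]
  simp only [leftTranslate, LinearMap.comp_apply, AlgHom.toLinearMap_apply]
  induction comul G a with
  | zero => simp
  | tmul x y => simp [tensorEval_tmul]
  | add x y hx hy =>
    simp only [map_add, Pi.add_apply, ← hx, ← hy]; rfl

lemma conv_evalAt_left {G : Subgroup (GL (Fin N) ℂ)} (g : G) (m : Pol G →ₗ[ℂ] ℂ) (a : Pol G) :
    conv (evalAt g).toLinearMap m a = m (leftTranslate g a) := by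
  simp only [conv, leftTranslate, LinearMap.comp_apply, AlgHom.toLinearMap_apply]
  induction comul G a with
  | zero => simp
  | tmul x y => simp
  | add x y hx hy => simp only [map_add, hx, hy]

lemma conv_eq_convRight {G : Subgroup (GL (Fin N) ℂ)} (l m : Pol G →ₗ[ℂ] ℂ) (a : Pol G) :
    conv l m a = l (convRight m a) := by
  simp only [conv, convRight, LinearMap.comp_apply, AlgHom.toLinearMap_apply]
  induction comul G a with
  | zero => simp
  | tmul x y => simp [mul_comm]
  | add x y hx hy => simp only [map_add, hx, hy]

/-- Pointwise form: `m` is applied to the function h ↦ a(gh). For a tangent functional this is a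
left-invariant vector field, for an invariant mean an average over a coset. -/
lemma convRight_apply {G : Subgroup (GL (Fin N) ℂ)} (m : Pol G →ₗ[ℂ] ℂ) (a : Pol G) (g : G) :
    (convRight m a).1 g = m (leftTranslate g a) := by
  rw [← conv_evalAt_left, conv_eq_convRight]; rfl

lemma slice_slice {G : Subgroup (GL (Fin N) ℂ)} [StarRing B] [StarModule ℂ B]
    {F : B →⋆ₐ[ℂ] B ⊗[ℂ] Pol G} (hF : IsAction G F)
    (l m : Pol G →ₗ[ℂ] ℂ) (b : B) :
    slice B l (F (slice B m (F b))) = slice B (conv l m) (F b) :=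
  slice_slice_of_coassoc F.toAlgHom.toLinearMap (comul G).toLinearMap (hF.coassoc b) l m

lemma slice_counit {G : Subgroup (GL (Fin N) ℂ)} [StarRing B] [StarModule ℂ B]
    {F : B →⋆ₐ[ℂ] B ⊗[ℂ] Pol G} (hF : IsAction G F) (b : B) :
    slice B (counit G).toLinearMap (F b) = b := hF.counit b

end Slices

/-! ### Restriction of actions -/

section Restriction

/-- The generators of Pol(G), being matrix entries, already extend to `H`. Freeness of the
restricted action depends on this. -/
lemma restrict_surjective {G H : Subgroup (GL (Fin N) ℂ)} (hGH : G ≤ H) :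
    Function.Surjective (restrict hGH) := by
  intro a
  induction a using StarAlgebra.adjoin_induction_subtype with
  | mem x h =>
    obtain ⟨i, j, rfl⟩ := h
    exact ⟨⟨_, entry_mem H i j⟩, rfl⟩
  | algebraMap r => exact ⟨algebraMap ℂ _ r, AlgHomClass.commutes _ r⟩
  | add x y hx hy =>
    obtain ⟨a, ha⟩ := hx; obtain ⟨b, hb⟩ := hy
    exact ⟨a + b, by rw [map_add, ha, hb]⟩
  | mul x y hx hy =>
    obtain ⟨a, ha⟩ := hx; obtain ⟨b, hb⟩ := hy
    exact ⟨a * b, by rw [map_mul, ha, hb]⟩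
  | star x hx =>
    obtain ⟨a, ha⟩ := hx
    exact ⟨star a, by rw [map_star, ha]⟩

/-- The restriction homomorphism as a linear map. -/
def restrictₗ {G H : Subgroup (GL (Fin N) ℂ)} (hGH : G ≤ H) : Pol H →ₗ[ℂ] Pol G :=
  (restrict hGH).toAlgHom.toLinearMap

@[simp] lemma restrictₗ_apply {G H : Subgroup (GL (Fin N) ℂ)} (hGH : G ≤ H) (a : Pol H) (g : G) :
    (restrictₗ hGH a).1 g = a.1 (Subgroup.inclusion hGH g) := rfl

lemma tensorEval_map_restrict {G H : Subgroup (GL (Fin N) ℂ)} (hGH : G ≤ H)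
    (t : Pol H ⊗[ℂ] Pol H) (p : G × G) :
    tensorEval G (TensorProduct.map (restrictₗ hGH) (restrictₗ hGH) t) p =
      tensorEval H t (Subgroup.inclusion hGH p.1, Subgroup.inclusion hGH p.2) := by
  induction t with
  | zero => simp
  | tmul a b => simp [tensorEval_tmul]
  | add x y hx hy => simp only [map_add, Pi.add_apply, hx, hy]

lemma comul_restrict {G H : Subgroup (GL (Fin N) ℂ)} (hGH : G ≤ H) (a : Pol H) :
    comul G (restrictₗ hGH a) =
      TensorProduct.map (restrictₗ hGH) (restrictₗ hGH) (comul H a) := by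
  apply tensorEval_injective G
  ext p
  rw [tensorEval_map_restrict, tensorEval_comul, tensorEval_comul]; simp

variable {B : Type*} [Ring B] [StarRing B] [Algebra ℂ B] [StarModule ℂ B]

lemma restrictAction_apply {G H : Subgroup (GL (Fin N) ℂ)} (hGH : G ≤ H)
    (Fs : B →⋆ₐ[ℂ] B ⊗[ℂ] Pol H) (b : B) :
    restrictAction hGH Fs b = TensorProduct.map LinearMap.id (restrictₗ hGH) (Fs b) := rfl

lemma slice_restrictAction {G H : Subgroup (GL (Fin N) ℂ)} (hGH : G ≤ H)
    (Fs : B →⋆ₐ[ℂ] B ⊗[ℂ] Pol H) (l : Pol G →ₗ[ℂ] ℂ) (b : B) :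
    slice B l (restrictAction hGH Fs b) = slice B (l ∘ₗ restrictₗ hGH) (Fs b) := by
  rw [restrictAction_apply, slice_map]

lemma isAction_restrictAction {G H : Subgroup (GL (Fin N) ℂ)} (hGH : G ≤ H)
    {Fs : B →⋆ₐ[ℂ] B ⊗[ℂ] Pol H} (hF : IsAction H Fs) : IsAction G (restrictAction hGH Fs) where
  coassoc b := coassoc_restrict Fs.toAlgHom.toLinearMap (restrictₗ hGH) (comul H).toLinearMap
    (comul G).toLinearMap (LinearMap.ext fun a => comul_restrict hGH a) (hF.coassoc b)
  counit b := by
    refine (slice_restrictAction hGH Fs (counit G).toLinearMap b).trans ?_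
    exact hF.counit b

lemma isFree_restrictAction {G H : Subgroup (GL (Fin N) ℂ)} (hGH : G ≤ H)
    {Fs : B →⋆ₐ[ℂ] B ⊗[ℂ] Pol H} (hF : IsFree H Fs) : IsFree G (restrictAction hGH Fs) := by
  intro a
  obtain ⟨a, rfl⟩ := restrict_surjective hGH a
  obtain ⟨m, b, q, h⟩ := hF a
  refine ⟨m, b, q, ?_⟩
  have := congrArg (Algebra.TensorProduct.map (AlgHom.id ℂ B) (restrict hGH).toAlgHom) h
  simp only [map_sum, map_mul, Algebra.TensorProduct.map_tmul, map_one] at this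
  exact this

end Restriction

/-! ### Tangential functionals -/

section Tangential

variable {H : Subgroup (GL (Fin N) ℂ)}

/-- The matrix entries, as polynomial functions. -/
def entry (H : Subgroup (GL (Fin N) ℂ)) (i j : Fin N) : Pol H := ⟨_, entry_mem H i j⟩

/-- Hermitian functionals on `Pol H` that are derivations relative to the counit. -/
structure IsTangential (D : Pol H →ₗ[ℂ] ℂ) : Prop where
  leibniz : ∀ a b, D (a * b) = D a * b.1 1 + a.1 1 * D b
  star : ∀ a, D (star a) = star (D a)

namespace IsTangential

variable {D E : Pol H →ₗ[ℂ] ℂ}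

lemma map_one (hD : IsTangential D) : D 1 = 0 := by
  have h := hD.leibniz 1 1
  have h1 : (1 : Pol H).1 1 = 1 := rfl
  rw [mul_one, h1, mul_one, one_mul] at h
  exact left_eq_add.1 h

lemma add (hD : IsTangential D) (hE : IsTangential E) : IsTangential (D + E) where
  leibniz a b := by
    simp only [LinearMap.add_apply, hD.leibniz, hE.leibniz]; ring
  star a := by simp only [LinearMap.add_apply, hD.star, hE.star, star_add]

/-- Compatibility with the involution restricts the scalars to real ones. -/
lemma real_smul (hD : IsTangential D) (c : ℝ) : IsTangential ((c : ℂ) • D) where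
  leibniz a b := by
    simp only [LinearMap.smul_apply, smul_eq_mul, hD.leibniz]; ring
  star a := by
    simp only [LinearMap.smul_apply, smul_eq_mul, hD.star, star_mul', Complex.star_def,
      Complex.conj_ofReal]

/-- A tangential functional is determined by its values on the matrix entries. -/
lemma ext (hD : IsTangential D) (hE : IsTangential E)
    (h : ∀ i j, D (entry H i j) = E (entry H i j)) : D = E := by
  ext a
  induction a using StarAlgebra.adjoin_induction_subtype with
  | mem x hx => obtain ⟨i, j, rfl⟩ := hx; exact h i j
  | algebraMap r =>
    rw [Algebra.algebraMap_eq_smul_one, map_smul, map_smul, hD.map_one, hE.map_one]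
  | add x y hx hy => rw [map_add, map_add, hx, hy]
  | mul x y hx hy => rw [hD.leibniz, hE.leibniz, hx, hy]
  -- Pol(H) is generated by the entries together with their conjugates; hermiticity is what controls
  -- the latter.
  | star x hx => rw [hD.star, hE.star, hx]

end IsTangential

lemma leftTranslate_mul (g : H) (a b : Pol H) :
    leftTranslate g (a * b) = leftTranslate g a * leftTranslate g b := by
  ext h
  change (leftTranslate g (a * b)).1 h = (leftTranslate g a).1 h * (leftTranslate g b).1 h
  simp only [leftTranslate_apply]; rfl

lemma leftTranslate_star (g : H) (a : Pol H) :
    leftTranslate g (star a) = star (leftTranslate g a) := by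
  ext h
  change (leftTranslate g (star a)).1 h = star ((leftTranslate g a).1 h)
  simp only [leftTranslate_apply]; rfl

lemma leftTranslate_apply_one (g : H) (a : Pol H) : (leftTranslate g a).1 1 = a.1 g := by
  rw [leftTranslate_apply, mul_one]

/-- Translating the Leibniz rule at 1 to every point makes the left-invariant field of `D` a
derivation of Pol(H). -/
lemma convRight_mul {D : Pol H →ₗ[ℂ] ℂ} (hD : IsTangential D) (a b : Pol H) :
    convRight D (a * b) = convRight D a * b + a * convRight D b := by
  ext g
  change (convRight D (a * b)).1 g = (convRight D a).1 g * b.1 g + a.1 g * (convRight D b).1 g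
  simp only [convRight_apply, leftTranslate_mul, hD.leibniz, leftTranslate_apply_one]

lemma convRight_star {D : Pol H →ₗ[ℂ] ℂ} (hD : IsTangential D) (a : Pol H) :
    convRight D (star a) = star (convRight D a) := by
  ext g
  change (convRight D (star a)).1 g = star ((convRight D a).1 g)
  simp only [convRight_apply, leftTranslate_star, hD.star]

lemma convRight_apply_one (D : Pol H →ₗ[ℂ] ℂ) (a : Pol H) : (convRight D a).1 1 = D a := by
  rw [convRight_apply]
  congr 1
  ext h
  simpa using leftTranslate_apply 1 a h

lemma leftTranslate_entry (g : H) (i j : Fin N) :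
    leftTranslate g (entry H i j) =
      ∑ k, ((g : GL (Fin N) ℂ) : Matrix (Fin N) (Fin N) ℂ) i k • entry H k j := by
  ext h
  refine (leftTranslate_apply g (entry H i j) h).trans ?_
  simp [entry, Matrix.mul_apply]

lemma convRight_entry (D : Pol H →ₗ[ℂ] ℂ) (i j : Fin N) :
    convRight D (entry H i j) = ∑ k, D (entry H k j) • entry H i k := by
  ext h
  refine (convRight_apply D (entry H i j) h).trans ?_
  rw [leftTranslate_entry, map_sum]
  simp only [map_smul, smul_eq_mul]
  simp [entry, mul_comm]

lemma conv_entry (D E : Pol H →ₗ[ℂ] ℂ) (i j : Fin N) :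
    conv D E (entry H i j) = ∑ k, D (entry H i k) * E (entry H k j) := by
  rw [conv_eq_convRight, convRight_entry]
  simp [mul_comm]

/-- Each convolution violates the Leibniz rule only by D(a)E(b) + E(a)D(b), which is symmetric in
`D` and `E` and cancels in the difference. -/
lemma IsTangential.commutator {D E : Pol H →ₗ[ℂ] ℂ} (hD : IsTangential D)
    (hE : IsTangential E) : IsTangential (conv D E - conv E D) where
  leibniz a b := by
    simp only [LinearMap.sub_apply, conv_eq_convRight, convRight_mul hD, convRight_mul hE,
      map_add, hD.leibniz, hE.leibniz, convRight_apply_one]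
    ring
  star a := by
    simp only [LinearMap.sub_apply, conv_eq_convRight, convRight_star hD, convRight_star hE,
      hD.star, hE.star, star_sub]

end Tangential

/-! ### Lie algebra elements as tangential functionals. -/

section Tangent

variable {H : Subgroup (GL (Fin N) ℂ)} {hH : IsCompact (H : Set (GL (Fin N) ℂ))}

/-- The one-parameter subgroup generated by an element of the Lie algebra. -/
def expCurve (X : lieAlg H hH) (t : ℝ) : H :=
  ⟨expGL (t • (X : Matrix (Fin N) (Fin N) ℂ)), X.2 t⟩

lemma expCurve_zero (X : lieAlg H hH) : expCurve X 0 = 1 := by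
  ext1; simp [expCurve, expGL_zero]

lemma expCurve_add (X : lieAlg H hH) (s t : ℝ) :
    expCurve X (s + t) = expCurve X s * expCurve X t := by
  ext1; ext1
  simp only [expCurve, Subgroup.coe_mul, Units.val_mul, coe_expGL, add_smul]
  exact Matrix.exp_add_of_commute _ _
    (((Commute.refl (X : Matrix (Fin N) (Fin N) ℂ)).smul_left s).smul_right t)

lemma expCurve_Ad (h : H) (X : lieAlg H hH) (t : ℝ) :
    expCurve (Ad H hH h X) t = h * expCurve X t * h⁻¹ := by
  ext1
  refine Eq.trans ?_ (expGL_conj (h : GL (Fin N) ℂ) (t • (X : Matrix (Fin N) (Fin N) ℂ)))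
  simp [expCurve, Ad]

lemma tangent_apply (X : lieAlg H hH) (a : Pol H) :
    tangent X a = deriv (fun t => a.1 (expCurve X t)) 0 := rfl

lemma hasDerivAt_tangent (X : lieAlg H hH) (a : Pol H) :
    HasDerivAt (fun t => a.1 (expCurve X t)) (tangent X a) 0 :=
  (differentiableAt_pol X.2 a 0).hasDerivAt

lemma isTangential_tangent (X : lieAlg H hH) : IsTangential (tangent X) where
  leibniz a b := by
    have := ((hasDerivAt_tangent X a).mul (hasDerivAt_tangent X b)).deriv
    simp only [expCurve_zero] at this
    exact this
  star a := (hasDerivAt_tangent X a).star.deriv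

lemma tangent_entry (X : lieAlg H hH) (i j : Fin N) :
    tangent X (entry H i j) = (X : Matrix (Fin N) (Fin N) ℂ) i j := by
  have := (hasDerivAt_pi.1 (hasDerivAt_pi.1 (hasDerivAt_expGL X.1 0) i) j).deriv
  simp only [zero_smul, expGL_zero, Units.val_one, one_mul] at this
  exact this

lemma tangent_add (X Y : lieAlg H hH) : tangent (X + Y) = tangent X + tangent Y :=
  (isTangential_tangent _).ext ((isTangential_tangent X).add (isTangential_tangent Y))
    fun i j => by simp [tangent_entry]

lemma tangent_smul (c : ℝ) (X : lieAlg H hH) : tangent (c • X) = (c : ℂ) • tangent X :=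
  (isTangential_tangent _).ext ((isTangential_tangent X).real_smul c)
    fun i j => by simp [tangent_entry]

lemma tangent_sum {ι : Type*} (s : Finset ι) (c : ι → ℝ) (X : ι → lieAlg H hH) :
    tangent (∑ i ∈ s, c i • X i) = ∑ i ∈ s, (c i : ℂ) • tangent (X i) := by
  classical
  induction s using Finset.induction_on with
  | empty => simpa using tangent_smul 0 (0 : lieAlg H hH)
  | insert i s hi ih => rw [Finset.sum_insert hi, Finset.sum_insert hi, tangent_add, tangent_smul, ih]

/-- Both sides are tangential, so matrix entries suffice; there convolution is matrix
multiplication. -/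
lemma tangent_lie (X Y : lieAlg H hH) :
    tangent ⁅X, Y⁆ = conv (tangent X) (tangent Y) - conv (tangent Y) (tangent X) :=
  (isTangential_tangent _).ext ((isTangential_tangent X).commutator (isTangential_tangent Y))
    fun i j => by
      simp only [LinearMap.sub_apply, conv_entry, tangent_entry, LieSubalgebra.coe_bracket,
        Ring.lie_def, Matrix.sub_apply, Matrix.mul_apply]

/-- Derivative at t = 0 of a(g exp(tX)) = a(exp(t Ad_g X) g). -/
lemma conv_evalAt_tangent (g : H) (X : lieAlg H hH) :
    conv (evalAt g).toLinearMap (tangent X) =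
      conv (tangent (Ad H hH g X)) (evalAt g).toLinearMap := by
  ext a
  rw [conv_evalAt_left, conv_eq_convRight, tangent_apply, tangent_apply]
  congr 1
  ext t
  rw [leftTranslate_apply, convRight_apply, AlgHom.toLinearMap_apply, evalAt_apply,
    leftTranslate_apply, expCurve_Ad, inv_mul_cancel_right]

/-- A polynomial function all of whose left translates are annihilated by `X` is constant along
the one-parameter subgroup of `X`. -/
lemma apply_expCurve_eq (X : lieAlg H hH) {a : Pol H}
    (ha : ∀ h, tangent X (leftTranslate h a) = 0) (t : ℝ) : a.1 (expCurve X t) = a.1 1 := by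
  have hd : ∀ t, HasDerivAt (fun t => a.1 (expCurve X t)) 0 t := by
    intro t
    -- By the one-parameter group law, translating by exp(tX) moves differentiation at `t` to
    -- differentiation at 0.
    have h1 := hasDerivAt_tangent X (leftTranslate (expCurve X t) a)
    rw [ha] at h1
    simp only [leftTranslate_apply, ← expCurve_add] at h1
    have h2 : HasDerivAt (fun s => a.1 (expCurve X (t + s))) 0 (t - t) := by simpa using h1
    have h3 := h2.comp_sub_const t t
    simpa using h3
  have := is_const_of_deriv_eq_zero (fun t => (hd t).differentiableAt) (fun t => (hd t).deriv) t 0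
  rw [this, expCurve_zero]

/-- The curve exp(tX) stays in `G`, so the derivative sees only the restriction of a function to
`G`. -/
lemma tangent_of_mem_subLie {G : Subgroup (GL (Fin N) ℂ)} {hG : IsCompact (G : Set (GL (Fin N) ℂ))}
    (hGH : G ≤ H) {X : lieAlg H hH} (hX : X ∈ subLie H hH G hG) :
    tangent X = tangent (⟨X, hX⟩ : lieAlg G hG) ∘ₗ restrictₗ hGH := rfl

end Tangent

/-! ### Induced derivations -/

section Induced

variable {B : Type*} [Ring B] [Algebra ℂ B] {H : Subgroup (GL (Fin N) ℂ)}

/-- On tensors F⋆(b) the counit slices return b, and this becomes the Leibniz rule on `B`. -/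
lemma slice_mul_of_isTangential {D : Pol H →ₗ[ℂ] ℂ} (hD : IsTangential D) (s t : B ⊗[ℂ] Pol H) :
    slice B D (s * t) = slice B D s * slice B (counit H).toLinearMap t +
      slice B (counit H).toLinearMap s * slice B D t := by
  induction s with
  | zero => simp
  | tmul b a =>
    induction t with
    | zero => simp
    | tmul c d =>
      have e : ∀ x : Pol H, (counit H).toLinearMap x = x.1 1 := fun _ => rfl
      simp only [Algebra.TensorProduct.tmul_mul_tmul, slice_tmul, hD.leibniz, e,
        smul_mul_smul_comm, add_smul]
    | add x y hx hy => simp only [mul_add, map_add, hx, hy]; abel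
  | add x y hx hy => simp only [add_mul, map_add, hx, hy]; abel

variable [StarRing B] [StarModule ℂ B]

lemma slice_star_of_isTangential {D : Pol H →ₗ[ℂ] ℂ} (hD : IsTangential D) (t : B ⊗[ℂ] Pol H) :
    slice B D (star t) = star (slice B D t) := by
  induction t with
  | zero => simp
  | tmul b a => simp [TensorProduct.star_tmul, hD.star]
  | add x y hx hy => simp only [star_add, map_add, hx, hy]

variable {hH : IsCompact (H : Set (GL (Fin N) ℂ))} {Fs : B →⋆ₐ[ℂ] B ⊗[ℂ] Pol H}

lemma inducedDerivation_apply (X : lieAlg H hH) (b : B) :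
    inducedDerivation Fs X b = slice B (tangent X) (Fs b) := rfl

lemma isHermitianDerivation_inducedDerivation (hF : IsAction H Fs) (X : lieAlg H hH) :
    IsHermitianDerivation (StarAlgHom.id ℂ B) (inducedDerivation Fs X) where
  leibniz f g := by
    simp only [inducedDerivation_apply, map_mul,
      slice_mul_of_isTangential (isTangential_tangent X), slice_counit hF]
    rfl
  hermitian f := by
    simp only [inducedDerivation_apply, map_star,
      slice_star_of_isTangential (isTangential_tangent X)]

lemma inducedDerivation_sum {ι : Type*} (s : Finset ι) (c : ι → ℝ) (X : ι → lieAlg H hH) (b : B) :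
    inducedDerivation Fs (∑ i ∈ s, c i • X i) b =
      ∑ i ∈ s, (c i : ℂ) • inducedDerivation Fs (X i) b := by
  simp only [inducedDerivation_apply, tangent_sum, slice_sum, slice_smul]

lemma inducedDerivation_lie (hF : IsAction H Fs) (X Y : lieAlg H hH) (b : B) :
    inducedDerivation Fs ⁅X, Y⁆ b = inducedDerivation Fs X (inducedDerivation Fs Y b) -
      inducedDerivation Fs Y (inducedDerivation Fs X b) := by
  simp only [inducedDerivation_apply, slice_slice hF, tangent_lie, slice_sub]

/-- Equivariance of the induced derivations. -/
lemma slice_evalAt_inducedDerivation (hF : IsAction H Fs) (g : H) (X : lieAlg H hH) (b : B) :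
    slice B (evalAt g).toLinearMap (Fs (inducedDerivation Fs X b)) =
      inducedDerivation Fs (Ad H hH g X) (slice B (evalAt g).toLinearMap (Fs b)) := by
  simp only [inducedDerivation_apply, slice_slice hF, conv_evalAt_tangent]

/-- For `X` in 𝔤 the operator factors through the restricted action, which sends a fixed `f` to f ⊗
1, and tangential functionals kill 1. -/
lemma inducedDerivation_eq_zero {G : Subgroup (GL (Fin N) ℂ)}
    {hG : IsCompact (G : Set (GL (Fin N) ℂ))} (hGH : G ≤ H) {X : lieAlg H hH}
    (hX : X ∈ subLie H hH G hG) {f : B} (hf : restrictAction hGH Fs f = f ⊗ₜ 1) :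
    inducedDerivation Fs X f = 0 := by
  rw [inducedDerivation_apply, tangent_of_mem_subLie hGH hX, ← slice_restrictAction, hf,
    slice_tmul, (isTangential_tangent _).map_one, zero_smul]

end Induced

/-! ### The adjoint representation on the orthogonal complement -/

section Adjoint

variable {H : Subgroup (GL (Fin N) ℂ)} {hH : IsCompact (H : Set (GL (Fin N) ℂ))}

lemma coe_Ad (h : H) (X : lieAlg H hH) :
    (Ad H hH h X : Matrix (Fin N) (Fin N) ℂ) = ((h : GL (Fin N) ℂ) : Matrix (Fin N) (Fin N) ℂ) * X *
    (((h : GL (Fin N) ℂ)⁻¹ : GL (Fin N) ℂ) : Matrix (Fin N) (Fin N) ℂ) := rfl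

lemma Ad_mul (g h : H) (X : lieAlg H hH) : Ad H hH (g * h) X = Ad H hH g (Ad H hH h X) := by
  ext1
  simp only [coe_Ad, Subgroup.coe_mul, _root_.mul_inv_rev, Units.val_mul, Matrix.mul_assoc]

lemma Ad_one (X : lieAlg H hH) : Ad H hH 1 X = X := by
  ext1
  simp [coe_Ad]

lemma Ad_inv_Ad (h : H) (X : lieAlg H hH) : Ad H hH h⁻¹ (Ad H hH h X) = X := by
  rw [← Ad_mul, inv_mul_cancel, Ad_one]

lemma Ad_Ad_inv (h : H) (X : lieAlg H hH) : Ad H hH h (Ad H hH h⁻¹ X) = X := by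
  rw [← Ad_mul, mul_inv_cancel, Ad_one]

lemma Ad_lie (h : H) (X Y : lieAlg H hH) : Ad H hH h ⁅X, Y⁆ = ⁅Ad H hH h X, Ad H hH h Y⁆ := by
  have e : ∀ g : GL (Fin N) ℂ, ((g⁻¹ : GL (Fin N) ℂ) : Matrix (Fin N) (Fin N) ℂ) * g = 1 := by
    intro g; rw [← Units.val_mul]; simp
  have e' : ∀ (g : GL (Fin N) ℂ) (Z W : Matrix (Fin N) (Fin N) ℂ),
      (g : Matrix (Fin N) (Fin N) ℂ) * Z * ((g⁻¹ : GL (Fin N) ℂ) : Matrix (Fin N) (Fin N) ℂ) *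
      (g * W * ((g⁻¹ : GL (Fin N) ℂ) : Matrix (Fin N) (Fin N) ℂ)) =
      g * (Z * W) * ((g⁻¹ : GL (Fin N) ℂ) : Matrix (Fin N) (Fin N) ℂ) := by
    intro g Z W
    rw [Matrix.mul_assoc (g : Matrix (Fin N) (Fin N) ℂ) W, Matrix.mul_assoc,
      ← Matrix.mul_assoc _ (g : Matrix (Fin N) (Fin N) ℂ), e, Matrix.one_mul]
    simp only [Matrix.mul_assoc]
  ext1
  simp only [coe_Ad, LieSubalgebra.coe_bracket, Ring.lie_def, e', Matrix.mul_sub, Matrix.sub_mul]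

/-- The adjoint action by automorphisms of the Lie algebra. -/
def AdEquiv (h : H) : lieAlg H hH ≃ₗ⁅ℝ⁆ lieAlg H hH where
  toFun := Ad H hH h
  map_add' := map_add _
  map_smul' := map_smul _
  map_lie' := Ad_lie h _ _
  invFun := Ad H hH h⁻¹
  left_inv := Ad_inv_Ad h
  right_inv := Ad_Ad_inv h

/-- The Killing form is invariant under Lie algebra automorphisms. -/
lemma killingScalar_Ad (h : H) (X Y : lieAlg H hH) :
    killingScalar H hH (Ad H hH h X) (Ad H hH h Y) = killingScalar H hH X Y :=
  congrArg Neg.neg (LieAlgebra.killingForm_of_equiv_apply (R := ℝ) (AdEquiv h) X Y)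

variable {G : Subgroup (GL (Fin N) ℂ)} {hG : IsCompact (G : Set (GL (Fin N) ℂ))}

lemma Ad_mem_subLie (hGH : G ≤ H) (g : G) {X : lieAlg H hH} (hX : X ∈ subLie H hH G hG) :
    Ad H hH (Subgroup.inclusion hGH g) X ∈ subLie H hH G hG :=
  conj_mem_lieSet g.2 hX

lemma mem_lieCompl {X : lieAlg H hH} :
    X ∈ lieCompl H hH G hG ↔ ∀ Y ∈ subLie H hH G hG, killingScalar H hH Y X = 0 :=
  LinearMap.BilinForm.mem_orthogonal_iff

lemma Ad_mem_lieCompl (hGH : G ≤ H) (g : G) {X : lieAlg H hH} (hX : X ∈ lieCompl H hH G hG) :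
    Ad H hH (Subgroup.inclusion hGH g) X ∈ lieCompl H hH G hG := by
  rw [mem_lieCompl] at hX ⊢
  intro Y hY
  rw [← killingScalar_Ad (Subgroup.inclusion hGH g)⁻¹, Ad_inv_Ad]
  exact hX _ (Ad_mem_subLie hGH g⁻¹ hY)

namespace IsOrthonormalBasisCompl

variable {n : ℕ} {ξ : Fin n → lieAlg H hH}

lemma killingScalar_sum_left (hξ : IsOrthonormalBasisCompl H hH G hG ξ) (c : Fin n → ℝ)
    (j : Fin n) : killingScalar H hH (∑ i, c i • ξ i) (ξ j) = c j := by
  simp [hξ.orthonormal]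

lemma killingScalar_sum_right (hξ : IsOrthonormalBasisCompl H hH G hG ξ) (c : Fin n → ℝ)
    (j : Fin n) : killingScalar H hH (ξ j) (∑ i, c i • ξ i) = c j := by
  simp [hξ.orthonormal]

lemma mem_lieCompl (hξ : IsOrthonormalBasisCompl H hH G hG ξ) (j : Fin n) :
    ξ j ∈ lieCompl H hH G hG := by
  rw [← hξ.span_eq]; exact Submodule.subset_span ⟨j, rfl⟩

/-- The spanning condition and orthonormality give the expansion directly, without nondegeneracy of
the form. -/
lemma sum_killingScalar_smul (hξ : IsOrthonormalBasisCompl H hH G hG ξ) {X : lieAlg H hH}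
    (hX : X ∈ lieCompl H hH G hG) : ∑ j, killingScalar H hH (ξ j) X • ξ j = X := by
  rw [← hξ.span_eq, Submodule.mem_span_range_iff_exists_fun] at hX
  obtain ⟨c, rfl⟩ := hX
  simp only [hξ.killingScalar_sum_right]

lemma Ad_eq_sum (hξ : IsOrthonormalBasisCompl H hH G hG ξ) (hGH : G ≤ H) (g : G) (i : Fin n) :
    Ad H hH (Subgroup.inclusion hGH g) (ξ i) = ∑ j,
      killingScalar H hH (ξ j) (Ad H hH (Subgroup.inclusion hGH g) (ξ i)) • ξ j :=
  (hξ.sum_killingScalar_smul (Ad_mem_lieCompl hGH g (hξ.mem_lieCompl i))).symm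

lemma killingScalar_Ad_mul (hξ : IsOrthonormalBasisCompl H hH G hG ξ) (hGH : G ≤ H) (g h : G)
    (i j : Fin n) :
    killingScalar H hH (ξ i) (Ad H hH (Subgroup.inclusion hGH (g * h)) (ξ j)) =
      ∑ k, killingScalar H hH (ξ i) (Ad H hH (Subgroup.inclusion hGH g) (ξ k)) *
        killingScalar H hH (ξ k) (Ad H hH (Subgroup.inclusion hGH h) (ξ j)) := by
  rw [map_mul, Ad_mul, hξ.Ad_eq_sum hGH h j]
  simp only [map_sum, map_smul, smul_eq_mul, hξ.killingScalar_sum_right]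
  exact Finset.sum_congr rfl fun k _ => mul_comm _ _

lemma sum_killingScalar_Ad (hξ : IsOrthonormalBasisCompl H hH G hG ξ) (hGH : G ≤ H) (g : G)
    (i j : Fin n) :
    ∑ k, killingScalar H hH (ξ k) (Ad H hH (Subgroup.inclusion hGH g) (ξ i)) *
      killingScalar H hH (ξ k) (Ad H hH (Subgroup.inclusion hGH g) (ξ j)) =
      if i = j then 1 else 0 := by
  rw [← hξ.orthonormal, ← killingScalar_Ad (Subgroup.inclusion hGH g) (ξ i) (ξ j)]
  conv_rhs => rw [hξ.Ad_eq_sum hGH g i]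
  simp only [map_sum, map_smul, LinearMap.sum_apply, LinearMap.smul_apply, smul_eq_mul]

end IsOrthonormalBasisCompl

lemma adjointRep_apply (hGH : G ≤ H) {n : ℕ} (ξ : Fin n → lieAlg H hH) (i j : Fin n) (g : G) :
    (adjointRep hH hG hGH ξ j i).1 g =
      ((killingScalar H hH (ξ j) (Ad H hH (Subgroup.inclusion hGH g) (ξ i)) : ℝ) : ℂ) := rfl

lemma isRealUnitaryRep_adjointRep (hGH : G ≤ H) {n : ℕ} {ξ : Fin n → lieAlg H hH}
    (hξ : IsOrthonormalBasisCompl H hH G hG ξ)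
    (hker : DiscreteTopology (repKernel G (adjointRep hH hG hGH ξ))) :
    IsRealUnitaryRep G (adjointRep hH hG hGH ξ) where
  comul i j := by
    apply tensorEval_injective G
    ext ⟨g, h⟩
    rw [tensorEval_comul]
    simp only [map_sum, Finset.sum_apply, tensorEval_tmul, adjointRep_apply,
      hξ.killingScalar_Ad_mul hGH g h]
    push_cast; rfl
  counit i j := by
    change (adjointRep hH hG hGH ξ i j).1 1 = _
    rw [adjointRep_apply, map_one, Ad_one, hξ.orthonormal]
    split_ifs <;> simp
  real i j := by
    ext g
    change star ((adjointRep hH hG hGH ξ i j).1 g) = (adjointRep hH hG hGH ξ i j).1 g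
    rw [adjointRep_apply, Complex.star_def, Complex.conj_ofReal]
  unitary := by
    -- For a square matrix over a commutative ring u*u = 1 is enough; it is checked pointwise on
    -- `G`, where the entries are real.
    rw [Matrix.mem_unitaryGroup_iff']
    ext i j g
    have h1 : ((star (adjointRep hH hG hGH ξ) * adjointRep hH hG hGH ξ) i j).1 g =
        ∑ k, star ((adjointRep hH hG hGH ξ k i).1 g) * (adjointRep hH hG hGH ξ k j).1 g := by
      rw [Matrix.mul_apply]
      have : ∀ f : Fin n → Pol G, (∑ k, f k).1 g = ∑ k, (f k).1 g := fun f => by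
        exact (map_sum (evalAt g) f Finset.univ)
      rw [this]; rfl
    have h2 : ((1 : Matrix (Fin n) (Fin n) (Pol G)) i j).1 g = if i = j then 1 else 0 := by
      rw [Matrix.one_apply]; split_ifs <;> rfl
    refine h1.trans (Eq.trans ?_ h2.symm)
    simp only [adjointRep_apply, Complex.star_def, Complex.conj_ofReal]
    rw [← Complex.ofReal_one, ← Complex.ofReal_zero, ← apply_ite Complex.ofReal,
      ← hξ.sum_killingScalar_Ad hGH g]
    push_cast; rfl
  discrete_kernel := hker

end Adjoint

/-! ### Averaging over a compact group -/

section Averaging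

lemma continuous_pol {G : Subgroup (GL (Fin N) ℂ)} (a : Pol G) : Continuous a.1 := by
  induction a using StarAlgebra.adjoin_induction_subtype with
  | mem x h =>
    obtain ⟨i, j, rfl⟩ := h
    exact (Units.continuous_val.comp continuous_subtype_val).matrix_elem i j
  | algebraMap r => exact continuous_const
  | add x y hx hy => exact hx.add hy
  | mul x y hx hy => exact hx.mul hy
  | star x hx => exact hx.star

/-- The normalized Haar integral on polynomial functions. -/
lemma exists_invariant_mean {G : Subgroup (GL (Fin N) ℂ)}
    (hG : IsCompact (G : Set (GL (Fin N) ℂ))) :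
    ∃ l : Pol G →ₗ[ℂ] ℂ, l 1 = 1 ∧ (∀ g a, l (leftTranslate g a) = l a) ∧
      ∀ (a : Pol G) (C : ℝ), (∀ g, ‖a.1 g‖ ≤ C) → ‖l a‖ ≤ C := by
  have : CompactSpace G := isCompact_iff_compactSpace.1 hG
  let _ : MeasurableSpace G := borel G
  have : BorelSpace G := ⟨rfl⟩
  -- Taking the whole group as reference compact set gives total mass 1.
  let μ : MeasureTheory.Measure G := MeasureTheory.Measure.haarMeasure ⊤
  have hμ : MeasureTheory.IsProbabilityMeasure μ :=
    ⟨MeasureTheory.Measure.haarMeasure_self (K₀ := (⊤ : TopologicalSpace.PositiveCompacts G))⟩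
  have hint : ∀ a : Pol G, MeasureTheory.Integrable a.1 μ := fun a =>
    (continuous_pol a).integrable_of_hasCompactSupport (HasCompactSupport.of_compactSpace _)
  refine ⟨{ toFun := fun a => ∫ g, a.1 g ∂μ
            map_add' := fun a b => MeasureTheory.integral_add (hint a) (hint b)
            map_smul' := fun c a => MeasureTheory.integral_const_mul c _ }, ?_, ?_, ?_⟩
  · change ∫ g : G, (1 : ℂ) ∂μ = 1
    simp
  · intro g a
    change ∫ h, (leftTranslate g a).1 h ∂μ = ∫ h, a.1 h ∂μ
    simp only [leftTranslate_apply]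
    exact MeasureTheory.integral_mul_left_eq_self (fun h => a.1 h) g
  · intro a C hC
    have := MeasureTheory.norm_integral_le_of_norm_le_const (μ := μ) (f := a.1) (C := C)
      (Eventually.of_forall hC)
    simpa using this

/-! ### Right G-invariant functions: projection, separation of cosets, differentials at 1. -/

variable {G H : Subgroup (GL (Fin N) ℂ)}

/-- Polynomial functions on `H` that are invariant under right translations by `G`. -/
def rightInvariants (hGH : G ≤ H) : Submodule ℂ (Pol H) where
  carrier := {a | ∀ (h : H) (g : G), a.1 (h * Subgroup.inclusion hGH g) = a.1 h}
  add_mem' ha hb h g := congrArg₂ (· + ·) (ha h g) (hb h g)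
  zero_mem' _ _ := rfl
  smul_mem' c _ ha h g := congrArg (c * ·) (ha h g)

lemma star_mem_rightInvariants {hGH : G ≤ H} {a : Pol H} (ha : a ∈ rightInvariants hGH) :
    star a ∈ rightInvariants hGH := fun h g => congrArg star (ha h g)

lemma leftTranslate_mem_rightInvariants {hGH : G ≤ H} {a : Pol H}
    (ha : a ∈ rightInvariants hGH) (k : H) : leftTranslate k a ∈ rightInvariants hGH := by
  intro h g
  rw [leftTranslate_apply, leftTranslate_apply, ← mul_assoc, ha]

lemma restrictₗ_leftTranslate (hGH : G ≤ H) (g : G) (a : Pol H) :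
    restrictₗ hGH (leftTranslate (Subgroup.inclusion hGH g) a) =
      leftTranslate g (restrictₗ hGH a) := by
  ext h
  refine (restrictₗ_apply hGH _ h).trans ((leftTranslate_apply _ _ _).trans ?_)
  refine Eq.trans ?_ (leftTranslate_apply _ _ _).symm
  rw [restrictₗ_apply, map_mul]

lemma leftTranslate_leftTranslate (g h : H) (a : Pol H) :
    leftTranslate g (leftTranslate h a) = leftTranslate (h * g) a := by
  ext k
  refine (leftTranslate_apply _ _ _).trans ((leftTranslate_apply _ _ _).trans ?_)
  refine Eq.trans ?_ (leftTranslate_apply _ _ _).symm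
  rw [mul_assoc]

/-- The value at `h` is the mean of g ↦ a(hg), which depends only on the coset hG. -/
lemma convRight_mem_rightInvariants {hGH : G ≤ H} {l : Pol G →ₗ[ℂ] ℂ}
    (hl : ∀ g a, l (leftTranslate g a) = l a) (a : Pol H) :
    convRight (l ∘ₗ restrictₗ hGH) a ∈ rightInvariants hGH := by
  intro h g
  rw [convRight_apply, convRight_apply, ← leftTranslate_leftTranslate, LinearMap.comp_apply,
    restrictₗ_leftTranslate, hl]; rfl

/-- An invariant function is constant on each coset, and the mean is normalized. -/
lemma convRight_eq_self {hGH : G ≤ H} {l : Pol G →ₗ[ℂ] ℂ} (hl : l 1 = 1) {a : Pol H}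
    (ha : a ∈ rightInvariants hGH) : convRight (l ∘ₗ restrictₗ hGH) a = a := by
  ext h
  refine (convRight_apply _ _ _).trans ?_
  have : restrictₗ hGH (leftTranslate h a) = a.1 h • (1 : Pol G) := by
    ext g
    refine (restrictₗ_apply hGH _ g).trans ((leftTranslate_apply _ _ _).trans ((ha h g).trans ?_))
    exact (mul_one _).symm
  rw [LinearMap.comp_apply, this, map_smul, hl, smul_eq_mul, mul_one]

/-- Polynomial functions are dense in the continuous functions. -/
lemma exists_pol_near (hH : IsCompact (H : Set (GL (Fin N) ℂ))) {f : H → ℝ} (hf : Continuous f)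
    {ε : ℝ} (hε : 0 < ε) : ∃ a : Pol H, ∀ h, ‖a.1 h - f h‖ ≤ ε := by
  have : CompactSpace H := isCompact_iff_compactSpace.1 hH
  let A : StarSubalgebra ℂ C(H, ℂ) :=
    { carrier := {f | (f : H → ℂ) ∈ Pol H}
      mul_mem' := fun ha hb => mul_mem (S := StarSubalgebra ℂ (H → ℂ)) (s := Pol H) ha hb
      add_mem' := fun ha hb => add_mem (S := StarSubalgebra ℂ (H → ℂ)) (s := Pol H) ha hb
      algebraMap_mem' := fun r => algebraMap_mem (Pol H) r
      star_mem' := fun ha => star_mem (s := Pol H) ha }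
  -- Matrix entries separate points, so Stone–Weierstrass applies.
  have hA : A.SeparatesPoints := by
    intro x y hxy
    by_contra! hne
    refine hxy (Subtype.ext (Units.ext (Matrix.ext fun i j => ?_)))
    exact hne _ ⟨⟨(entry H i j).1, continuous_pol _⟩, (entry H i j).2, rfl⟩
  have htop := ContinuousMap.starSubalgebra_topologicalClosure_eq_top_of_separatesPoints A hA
  let F : C(H, ℂ) := ⟨fun h => (f h : ℂ), Complex.continuous_ofReal.comp hf⟩
  have hF : F ∈ closure (A : Set C(H, ℂ)) := by
    rw [← StarSubalgebra.topologicalClosure_coe, htop]; trivial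
  obtain ⟨p, hp, hd⟩ := Metric.mem_closure_iff.1 hF ε hε
  refine ⟨⟨p, hp⟩, fun h => ?_⟩
  rw [← dist_eq_norm, dist_comm]
  exact (ContinuousMap.dist_apply_le_dist (f := F) (g := p) h).trans hd.le

/-- The right `G`-invariant polynomial functions on `H` separate `G` from other cosets. -/
lemma exists_rightInvariant_ne (hH : IsCompact (H : Set (GL (Fin N) ℂ)))
    (hG : IsCompact (G : Set (GL (Fin N) ℂ))) (hGH : G ≤ H) {h : H}
    (hh : (h : GL (Fin N) ℂ) ∉ G) : ∃ a ∈ rightInvariants hGH, a.1 h ≠ a.1 1 := by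
  have : CompactSpace H := isCompact_iff_compactSpace.1 hH
  have hcl : IsClosed {k : H | (k : GL (Fin N) ℂ) ∈ G} := hG.isClosed.preimage continuous_subtype_val
  -- This set is the coset hG, disjoint from `G`; Urysohn's lemma gives `f` equal to 0 on `G` and 1
  -- on hG.
  have hcl' : IsClosed {k : H | ((h⁻¹ * k : H) : GL (Fin N) ℂ) ∈ G} :=
    hG.isClosed.preimage (continuous_subtype_val.comp (continuous_const.mul continuous_id))
  obtain ⟨f, hf0, hf1, -⟩ := exists_continuous_zero_one_of_isClosed hcl hcl' (by
    rw [Set.disjoint_left]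
    intro k (hk : (k : GL (Fin N) ℂ) ∈ G) (hk' : ((h⁻¹ * k : H) : GL (Fin N) ℂ) ∈ G)
    apply hh
    have := G.mul_mem hk (G.inv_mem hk')
    simpa using this)
  -- Any error below 1/2 would do: equal averages over the two cosets would give 1 ≤ 1/3 + 1/3.
  obtain ⟨p, hp⟩ := exists_pol_near hH f.continuous (ε := 1 / 3) (by norm_num)
  obtain ⟨l, hl1, hl2, hl3⟩ := exists_invariant_mean hG
  refine ⟨convRight (l ∘ₗ restrictₗ hGH) p, convRight_mem_rightInvariants hl2 p, fun heq => ?_⟩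
  -- Where `f` is constant on a coset, averaging `p` over that coset does not enlarge the error.
  have key : ∀ (k : H) (c : ℝ), (∀ g : G, f (k * Subgroup.inclusion hGH g) = c) →
      ‖(convRight (l ∘ₗ restrictₗ hGH) p).1 k - c‖ ≤ 1 / 3 := by
    intro k c hc
    have e : (convRight (l ∘ₗ restrictₗ hGH) p).1 k - c =
        l (restrictₗ hGH (leftTranslate k p) - (c : ℂ) • (1 : Pol G)) := by
      rw [convRight_apply, map_sub, map_smul, hl1, smul_eq_mul, mul_one]; rfl
    rw [e]
    refine hl3 _ _ fun g => ?_
    have e2 : (restrictₗ hGH (leftTranslate k p) - (c : ℂ) • (1 : Pol G)).1 g =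
        p.1 (k * Subgroup.inclusion hGH g) - f (k * Subgroup.inclusion hGH g) := by
      rw [hc, ← leftTranslate_apply]
      change _ - (c : ℂ) * 1 = _
      rw [mul_one]; rfl
    rw [e2]
    exact hp _
  have k0 := key 1 0 fun g => hf0 (by simp)
  have k1 := key h 1 fun g => hf1 (by simp)
  rw [heq] at k1
  generalize (convRight (l ∘ₗ restrictₗ hGH) p).1 1 = z at k0 k1
  have : ‖(1 : ℂ)‖ ≤ 1 / 3 + 1 / 3 := by
    have e : (1 : ℂ) = (z - (0 : ℝ)) - (z - (1 : ℝ)) := by push_cast; ring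
    rw [e]
    exact (norm_sub_le _ _).trans (add_le_add k0 k1)
  norm_num at this

/-- Invariants are stable under left translation, so if `X` kills them all they are constant along
exp(tX). As they separate `G` from other cosets, the curve cannot leave `G`. -/
lemma mem_subLie_of_tangent_eq_zero {hH : IsCompact (H : Set (GL (Fin N) ℂ))}
    {hG : IsCompact (G : Set (GL (Fin N) ℂ))} (hGH : G ≤ H) {X : lieAlg H hH}
    (hX : ∀ a ∈ rightInvariants hGH, tangent X a = 0) : X ∈ subLie H hH G hG := by
  intro t
  by_contra hne
  obtain ⟨a, ha, hne⟩ := exists_rightInvariant_ne hH hG hGH (h := expCurve X t) hne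
  exact hne (apply_expCurve_eq X (fun h => hX _ (leftTranslate_mem_rightInvariants ha h)) t)

/-- The tangent vectors `ξ j` are dual to differentials of right invariant functions. -/
lemma exists_rightInvariant_tangent {hH : IsCompact (H : Set (GL (Fin N) ℂ))}
    {hG : IsCompact (G : Set (GL (Fin N) ℂ))} (hGH : G ≤ H) {n : ℕ} {ξ : Fin n → lieAlg H hH}
    (hξ : IsOrthonormalBasisCompl H hH G hG ξ) (v : Fin n → ℂ) :
    ∃ a ∈ rightInvariants hGH, ∀ j, tangent (ξ j) a = v j := by
  let T : Pol H →ₗ[ℂ] (Fin n → ℂ) := LinearMap.pi fun j => tangent (ξ j)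
  -- If the image were proper, a nonzero complex covector `c` would annihilate it.
  suffices h : (rightInvariants hGH).map T = ⊤ by
    obtain ⟨a, ha, hav⟩ : v ∈ (rightInvariants hGH).map T := h ▸ Submodule.mem_top
    exact ⟨a, ha, fun j => congrFun hav j⟩
  by_contra hne
  obtain ⟨f, hf0, hf⟩ := Submodule.exists_le_ker_of_lt_top _ (lt_top_iff_ne_top.2 hne)
  set c : Fin n → ℂ := fun j => f (Pi.single j 1) with hc
  have hfc : ∀ w, f w = ∑ j, w j * c j := fun w => by
    conv_lhs => rw [pi_eq_sum_univ' w]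
    simp only [map_sum, map_smul, smul_eq_mul, hc]
  have h0 : ∀ a ∈ rightInvariants hGH, ∑ j, tangent (ξ j) a * c j = 0 := fun a ha => by
    rw [← hfc]; exact hf ⟨a, ha, rfl⟩
  -- The invariants are closed under the involution and the functionals are hermitian, so the
  -- conjugate covector also annihilates; real and imaginary parts can then be treated separately.
  have h0' : ∀ a ∈ rightInvariants hGH, ∑ j, tangent (ξ j) a * star (c j) = 0 := fun a ha => by
    have := congrArg star (h0 _ (star_mem_rightInvariants ha))
    simpa [(isTangential_tangent _).star, star_sum, mul_comm] using this
  -- A real annihilating combination of the ξ_j lies in 𝔤; pairing it with each ξ_j ∈ 𝔤^⊥ recovers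
  -- the coefficient, which is therefore 0.
  have hzero : ∀ r : Fin n → ℝ,
      (∀ a ∈ rightInvariants hGH, ∑ j, (r j : ℂ) * tangent (ξ j) a = 0) → r = 0 := by
    intro r hr
    have hmem : ∑ j, r j • ξ j ∈ subLie H hH G hG := mem_subLie_of_tangent_eq_zero hGH
      fun a ha => by simpa [tangent_sum] using hr a ha
    ext j
    rw [← hξ.killingScalar_sum_left r j]
    exact mem_lieCompl.1 (hξ.mem_lieCompl j) _ hmem
  have hre : (fun j => (c j).re) = 0 := hzero _ fun a ha => by
    have : ∀ j, (((c j).re : ℝ) : ℂ) * tangent (ξ j) a =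
        2⁻¹ * (tangent (ξ j) a * c j) + 2⁻¹ * (tangent (ξ j) a * star (c j)) := fun j => by
      rw [Complex.re_eq_add_conj, Complex.star_def]; ring
    simp only [this, Finset.sum_add_distrib, ← Finset.mul_sum, h0 a ha, h0' a ha]; simp
  have him : (fun j => (c j).im) = 0 := hzero _ fun a ha => by
    have : ∀ j, (((c j).im : ℝ) : ℂ) * tangent (ξ j) a = (2 * Complex.I)⁻¹ *
        (tangent (ξ j) a * c j) - (2 * Complex.I)⁻¹ * (tangent (ξ j) a * star (c j)) := fun j => by
      rw [Complex.im_eq_sub_conj, Complex.star_def]; ring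
    simp only [this, Finset.sum_sub_distrib, ← Finset.mul_sum, h0 a ha, h0' a ha]; simp
  apply hf0
  ext w
  rw [LinearMap.comp_apply, hfc]
  refine Finset.sum_eq_zero fun j _ => ?_
  rw [show c j = 0 from Complex.ext (congrFun hre j) (congrFun him j), mul_zero]

end Averaging

/-! ### The frame structure -/

section Frame

variable {B : Type*} [Ring B] [StarRing B] [Algebra ℂ B] [StarModule ℂ B]
  {G H : Subgroup (GL (Fin N) ℂ)} {hH : IsCompact (H : Set (GL (Fin N) ℂ))}
  {hG : IsCompact (G : Set (GL (Fin N) ℂ))} {Fs : B →⋆ₐ[ℂ] B ⊗[ℂ] Pol H}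

lemma mem_fixedSubalgebra {F : B →⋆ₐ[ℂ] B ⊗[ℂ] Pol G} {b : B} :
    b ∈ fixedSubalgebra G F ↔ F b = b ⊗ₜ 1 := Iff.rfl

lemma slice_evalAt_restrictAction (hGH : G ≤ H) (g : G) (b : B) :
    slice B (evalAt g).toLinearMap (restrictAction hGH Fs b) =
      slice B (evalAt (Subgroup.inclusion hGH g)).toLinearMap (Fs b) :=
  slice_restrictAction hGH Fs _ b

lemma slice_evalAt_restrictAction_inducedDerivation (haction : IsAction H Fs) (hGH : G ≤ H) {n : ℕ}
    {ξ : Fin n → lieAlg H hH} (hξ : IsOrthonormalBasisCompl H hH G hG ξ) (j : Fin n) (b : B)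
    (g : G) :
    slice B (evalAt g).toLinearMap (restrictAction hGH Fs (inducedDerivation Fs (ξ j) b)) =
      ∑ k, (adjointRep hH hG hGH ξ k j).1 g • inducedDerivation Fs (ξ k)
        (slice B (evalAt g).toLinearMap (restrictAction hGH Fs b)) := by
  rw [slice_evalAt_restrictAction, slice_evalAt_restrictAction,
    slice_evalAt_inducedDerivation haction, hξ.Ad_eq_sum hGH, inducedDerivation_sum]
  rfl

lemma slice_evalAt_map_mulLeft {M : Type*} [Ring M] [Algebra ℂ M] (X : M →ₗ[ℂ] M) (u : Pol G)
    (g : G) (t : M ⊗[ℂ] Pol G) :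
    slice M (evalAt g).toLinearMap (TensorProduct.map X (LinearMap.mulLeft ℂ u) t) =
      u.1 g • X (slice M (evalAt g).toLinearMap t) := by
  induction t with
  | zero => simp
  | tmul b a => simp [mul_smul]
  | add x y hx hy => simp only [map_add, hx, hy, smul_add]

/-- Evaluated at g ∈ G, this is equivariance with Ad_g ξ_j expanded in the basis `ξ` of the
invariant subspace 𝔤^⊥. -/
lemma restrictAction_inducedDerivation (haction : IsAction H Fs) (hGH : G ≤ H) {n : ℕ}
    {ξ : Fin n → lieAlg H hH} (hξ : IsOrthonormalBasisCompl H hH G hG ξ) (j : Fin n) (b : B) :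
    restrictAction hGH Fs (inducedDerivation Fs (ξ j) b) =
      ∑ k, TensorProduct.map (inducedDerivation Fs (ξ k))
        (LinearMap.mulLeft ℂ (adjointRep hH hG hGH ξ k j)) (restrictAction hGH Fs b) := by
  refine tensor_ext fun g => ?_
  rw [slice_evalAt_restrictAction_inducedDerivation haction hGH hξ, map_sum]
  simp only [slice_evalAt_map_mulLeft]

/-- Averaging over `G` maps into the fixed elements. -/
lemma slice_invariant_mem_fixedSubalgebra (haction : IsAction H Fs) (hGH : G ≤ H)
    {l : Pol G →ₗ[ℂ] ℂ} (hl : ∀ g a, l (leftTranslate g a) = l a) (b : B) :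
    slice B (l ∘ₗ restrictₗ hGH) (Fs b) ∈ fixedSubalgebra G (restrictAction hGH Fs) := by
  rw [mem_fixedSubalgebra]
  refine tensor_ext fun g => ?_
  rw [slice_evalAt_restrictAction, slice_slice haction, slice_tmul]
  -- Left invariance of the mean absorbs the evaluation at `g`.
  have : conv (evalAt (Subgroup.inclusion hGH g)).toLinearMap (l ∘ₗ restrictₗ hGH) =
      l ∘ₗ restrictₗ hGH := by
    ext a
    rw [conv_evalAt_left, LinearMap.comp_apply, restrictₗ_leftTranslate, hl]; rfl
  rw [this]
  exact (one_smul ℂ _).symm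

/-- The core of completeness: freeness is applied to an invariant `a` with ξ_j(a) = c_j, and the
resulting q_α are averaged over `G`. -/
lemma exists_sum_mul_restrictedDerivation (haction : IsAction H Fs) (hfree : IsFree H Fs)
    (hGH : G ≤ H) {n : ℕ} {ξ : Fin n → lieAlg H hH}
    (hξ : IsOrthonormalBasisCompl H hH G hG ξ) (c : Fin n → ℂ) :
    ∃ (m : ℕ) (b : Fin m → B) (v : Fin m → fixedSubalgebra G (restrictAction hGH Fs)),
      ∀ j, ∑ α, b α * restrictedDerivation hGH Fs (ξ j) (v α) = c j • 1 := by
  obtain ⟨a, ha, hac⟩ := exists_rightInvariant_tangent hGH hξ c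
  obtain ⟨l, hl1, hl2, -⟩ := exists_invariant_mean hG
  obtain ⟨m, b, q, hbq⟩ := hfree a
  refine ⟨m, b, fun α => ⟨_, slice_invariant_mem_fixedSubalgebra haction hGH hl2 (q α)⟩,
    fun j => ?_⟩
  have e : ∀ α, restrictedDerivation hGH Fs (ξ j)
      ⟨_, slice_invariant_mem_fixedSubalgebra haction hGH hl2 (q α)⟩ =
      slice B (conv (tangent (ξ j)) (l ∘ₗ restrictₗ hGH)) (Fs (q α)) := fun α =>
    slice_slice haction _ _ _
  simp only [e, ← slice_tmul_one_mul]
  -- Freeness collapses the sum to 1 ⊗ a. The convolved functional is ξ_j after averaging, and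
  -- averaging fixes `a`.
  rw [← map_sum, hbq, slice_tmul, conv_eq_convRight, convRight_eq_self hl1 ha, hac]

lemma isFrameStructure (haction : IsAction H Fs) (hfree : IsFree H Fs) (hGH : G ≤ H) {n : ℕ}
    {ξ : Fin n → lieAlg H hH} (hξ : IsOrthonormalBasisCompl H hH G hG ξ)
    (hker : DiscreteTopology (repKernel G (adjointRep hH hG hGH ξ))) :
    IsFrameStructure G (fixedSubalgebra G (restrictAction hGH Fs)).subtype
      (restrictAction hGH Fs) (adjointRep hH hG hGH ξ)
      (fun k => restrictedDerivation hGH Fs (ξ k)) where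
  bundle :=
    { injective := Subtype.val_injective
      mem_range_iff := fun b => ⟨fun ⟨v, hv⟩ => hv ▸ v.2, fun h => ⟨⟨b, h⟩, rfl⟩⟩
      action := isAction_restrictAction hGH haction
      free := isFree_restrictAction hGH hfree }
  rep := isRealUnitaryRep_adjointRep hGH hξ hker
  derivation k :=
    { leibniz := fun f g =>
        (isHermitianDerivation_inducedDerivation haction (ξ k)).leibniz f.1 g.1
      hermitian := fun f =>
        (isHermitianDerivation_inducedDerivation haction (ξ k)).hermitian f.1 }
  covariant k f := by
    refine (restrictAction_inducedDerivation haction hGH hξ k f.1).trans ?_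
    rw [mem_fixedSubalgebra.1 f.2]
    simp only [TensorProduct.map_tmul, LinearMap.mulLeft_apply, mul_one]
    rfl
  complete := by
    choose m b v hbv using fun k : Fin n =>
      exists_sum_mul_restrictedDerivation haction hfree hGH hξ (Pi.single k 1)
    -- The lengths `m k` depend on `k`, while a single `d` is required: the families are
    -- concatenated, and the coefficients for `k` are set to 0 outside the `k`-th block.
    let e := finSigmaFinEquiv (m := n) (n := m)
    refine ⟨∑ k, m k, fun k α => if (e.symm α).1 = k then b _ (e.symm α).2 else 0,
      fun _ α => v _ (e.symm α).2, fun k j => ?_⟩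
    rw [e.symm.sum_comp fun α => (if α.1 = k then b _ α.2 else 0) *
      restrictedDerivation hGH Fs (ξ j) (v _ α.2), Fintype.sum_sigma]
    rw [Finset.sum_eq_single k (fun k' _ hk' => by simp [hk']) (by simp)]
    simp only [if_true, hbv, Pi.single_apply, ite_smul, one_smul, zero_smul, eq_comm]

/-- The torsion on a fixed element is X_[ξ_j, ξ_k], which vanishes there since the bracket lies in
𝔤. -/
lemma isFrameExtension (haction : IsAction H Fs) (hGH : G ≤ H) {n : ℕ}
    {ξ : Fin n → lieAlg H hH} (hξ : IsOrthonormalBasisCompl H hH G hG ξ)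
    (hsymm : ∀ x ∈ lieCompl H hH G hG, ∀ y ∈ lieCompl H hH G hG, ⁅x, y⁆ ∈ subLie H hH G hG) :
    IsFrameExtension G (fixedSubalgebra G (restrictAction hGH Fs)).subtype
      (restrictAction hGH Fs) (adjointRep hH hG hGH ξ)
      (fun k => restrictedDerivation hGH Fs (ξ k)) (fun k => inducedDerivation Fs (ξ k)) where
  derivation j := isHermitianDerivation_inducedDerivation haction (ξ j)
  covariant := restrictAction_inducedDerivation haction hGH hξ
  restricts _ _ := rfl
  torsion_free j k f := (inducedDerivation_lie haction (ξ j) (ξ k) f.1).symm.trans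
    (inducedDerivation_eq_zero hGH (hsymm _ (hξ.mem_lieCompl j) _ (hξ.mem_lieCompl k)) f.2)

end Frame

end

end FramedBundle

open FramedBundle in
theorem mainTheorem4 {N : ℕ}
    (H : Subgroup (GL (Fin N) ℂ)) (hH : IsCompact (H : Set (GL (Fin N) ℂ)))
    (hsimple : LieAlgebra.IsSimple ℝ (lieAlg H hH))
    {B : Type*} [Ring B] [StarRing B] [Algebra ℂ B] [StarModule ℂ B]
    (Fs : B →⋆ₐ[ℂ] B ⊗[ℂ] Pol H) (haction : IsAction H Fs) (hfree : IsFree H Fs)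
    (G : Subgroup (GL (Fin N) ℂ)) (hG : IsCompact (G : Set (GL (Fin N) ℂ))) (hGH : G ≤ H)
    {n : ℕ} (ξ : Fin n → lieAlg H hH) (hξ : IsOrthonormalBasisCompl H hH G hG ξ)
    (hker : DiscreteTopology (repKernel G (adjointRep hH hG hGH ξ))) :
    IsFrameStructure G (fixedSubalgebra G (restrictAction hGH Fs)).subtype
        (restrictAction hGH Fs) (adjointRep hH hG hGH ξ)
        (fun k => restrictedDerivation hGH Fs (ξ k)) ∧
      ((∀ x ∈ lieCompl H hH G hG, ∀ y ∈ lieCompl H hH G hG, ⁅x, y⁆ ∈ subLie H hH G hG) →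
        IsIntegrableFrameStructure G (fixedSubalgebra G (restrictAction hGH Fs)).subtype
          (restrictAction hGH Fs) (adjointRep hH hG hGH ξ)
          (fun k => restrictedDerivation hGH Fs (ξ k)) ∧
        IsFrameExtension G (fixedSubalgebra G (restrictAction hGH Fs)).subtype
          (restrictAction hGH Fs) (adjointRep hH hG hGH ξ)
          (fun k => restrictedDerivation hGH Fs (ξ k))
          (fun k => inducedDerivation Fs (ξ k))) :=
  ⟨isFrameStructure haction hfree hGH hξ hker, fun hsymm =>
    ⟨⟨isFrameStructure haction hfree hGH hξ hker, _, isFrameExtension haction hGH hξ hsymm⟩,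
      isFrameExtension haction hGH hξ hsymm⟩⟩
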